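/- Let $\mathbb{K}$ be a field of characteristic zero. Permutations of all sizes $n\ge 0$ are written as words, a permutation of size $n$ being a rearrangement of $12\cdots n$. Let $\mathbf{FQSym}$ be the associative algebra with basis $\{\mathbf{F}_\sigma\}$ indexed by all permutations, unit $\mathbf{F}_\epsilon$ (with $\epsilon$ the empty permutation) and product $\mathbf{F}_\sigma\cdot\mathbf{F}_\nu=\sum_\pi \mathbf{F}_\pi$, where $\pi$ runs over the shuffles of $\sigma$ with the word obtained from $\nu$ by adding $|\sigma|$ to each letter. The canopy of a binary tree is the word recording, from left to right, the orientations of its leaves except the first and the last ($0$ for a leaf that is a right child, $1$ for a left child). A pair of twin binary trees is a pair $J=(T_L,T_R)$ of binary trees with the same number of nodes and complementary canopies. The $\mathbb{P}$-symbol of a permutation $\sigma$ is the pair of twin binary trees obtained by inserting the letters of $\sigma$ from left to right, starting from two empty trees, by leaf insertion into $T_L$ (the letter $a$ becomes a new leaf node of the binary search tree $T_L$) and by root insertion into $T_R$ (the new root is $a$, its left and right subtrees being the restrictions of $T_R$ to the labels $\le a$ and $>a$, with the induced ancestor relation), and by then forgetting the labels. For a pair of twin binary trees $J$ put $\mathbf{P}_J=\sum_{\mathbb{P}(\sigma)=J}\mathbf{F}_\sigma$,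 and let $\mathbf{Baxter}$ be the linear span of all the $\mathbf{P}_J$ in $\mathbf{FQSym}$. Write $J\le_{\mathrm B}J'$ if there are permutations $\sigma,\sigma'$ with $\mathbb{P}(\sigma)=J$, $\mathbb{P}(\sigma')=J'$ and $\sigma\le\sigma'$ in the right permutohedron order (the reflexive transitive closure of $u\,ab\,v<u\,ba\,v$ for letters $a<b$), and put $\mathbf{E}_J=\sum_{J\le_{\mathrm B}J'}\mathbf{P}_{J'}$. A permutation $\sigma$ is connected if it is nonempty and if, whenever $\sigma$ is the concatenation of a permutation $\nu$ and of the letters of a permutation $\pi$ incremented by $|\nu|$, one has $\nu=\sigma$ or $\pi=\sigma$. A Baxter permutation is one with no subword $u_1u_2u_3u_4$, with $u_2,u_3$ adjacent in the permutation, whose standardization is $2413$ or $3142$. A pair of twin binary trees $J$ is connected if the (unique) Baxter permutation with $\mathbb{P}$-symbol $J$ is connected. Then $\mathbf{Baxter}$ is a subalgebra of $\mathbf{FQSym}$, and it is the free associative unital $\mathbb{K}$-algebra on the elements $\mathbf{E}_J$, where $J$ runs over the connected pairs of twin binary trees: there is an isomorphism of algebras from the free algebra on the set of these $J$ onto $\mathbf{Baxter}$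 which maps the generator $J$ to $\mathbf{E}_J$. -/

import Mathlib

namespace BaxterAlgebra

/-! ### Permutations as words -/

/-- A word is (the one-line notation of) a permutation of size `n` when it is a rearrangement of
`1 2 ⋯ n`, where `n` is its length. -/
def IsPermWord (w : List ℕ) : Prop := w.Perm (List.range' 1 w.length)

instance (w : List ℕ) : Decidable (IsPermWord w) := by unfold IsPermWord; infer_instance

/-- Permutations of all sizes `n ≥ 0`, in one-line notation. -/
abbrev SPerm : Type := {w : List ℕ // IsPermWord w}

/-- The letters of a word, incremented by `k`. -/
def shift (k : ℕ) (w : List ℕ) : List ℕ := w.map (· + k)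

/-- The word `u ⟋ v`: `u` followed by the letters of `v` incremented by the length of `u`. -/
def slash (u v : List ℕ) : List ℕ := u ++ shift u.length v

/-- The empty permutation. -/
def SPerm.empty : SPerm := ⟨[], List.Perm.refl _⟩

/-- A permutation `σ` is connected if it is nonempty and `σ = ν ⟋ π` implies `ν = σ` or `π = σ`. -/
def SPerm.IsConnected (σ : SPerm) : Prop :=
  σ ≠ SPerm.empty ∧ ∀ ν π : SPerm, σ.1 = slash ν.1 π.1 → ν = σ ∨ π = σ

/-- A permutation is a Baxter permutation if it has no subword `p q r s`, with `q` and `r`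
adjacent, whose standardization is `2413` or `3142`. -/
def SPerm.IsBaxter (σ : SPerm) : Prop :=
  ∀ (x u v y : List ℕ) (p q r s : ℕ), σ.1 = x ++ [p] ++ u ++ [q, r] ++ v ++ [s] ++ y →
    ¬ (r < p ∧ p < s ∧ s < q) ∧ ¬ (q < s ∧ s < p ∧ p < r)

/-- One step up in the permutohedron: two adjacent letters `a < b` are exchanged. -/
def SPerm.Covers (σ ν : SPerm) : Prop :=
  ∃ (u v : List ℕ) (a b : ℕ), a < b ∧ σ.1 = u ++ [a, b] ++ v ∧ ν.1 = u ++ [b, a] ++ v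

/-- The (right) permutohedron order. -/
def SPerm.PermLE : SPerm → SPerm → Prop := Relation.ReflTransGen SPerm.Covers

/-- The finite set of permutations of size `n`. -/
def permsOfSize (n : ℕ) : Finset SPerm :=
  (List.range' 1 n).permutations.toFinset.subtype IsPermWord

theorem mem_permsOfSize {n : ℕ} {σ : SPerm} : σ ∈ permsOfSize n ↔ σ.1.length = n := by
  simp only [permsOfSize, Finset.mem_subtype, List.mem_toFinset, List.mem_permutations]
  constructor
  · intro h
    simpa using h.length_eq
  · rintro rfl
    exact σ.2

/-! ### The shifted shuffle product -/

/-- The shuffle product of two words, as a multiset of words. -/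
def shuffle : List ℕ → List ℕ → Multiset (List ℕ)
  | [], v => {v}
  | a :: u, [] => {a :: u}
  | a :: u, b :: v =>
    (shuffle u (b :: v)).map (List.cons a) + (shuffle (a :: u) v).map (List.cons b)
  termination_by u v => u.length + v.length

theorem shuffle_nil_left (v : List ℕ) : shuffle [] v = {v} := by rw [shuffle]

theorem shuffle_nil_right (u : List ℕ) : shuffle u [] = {u} := by cases u <;> rw [shuffle]

theorem shuffle_cons (a b : ℕ) (u v : List ℕ) : shuffle (a :: u) (b :: v) =
    (shuffle u (b :: v)).map (List.cons a) + (shuffle (a :: u) v).map (List.cons b) := by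
  rw [shuffle]

theorem perm_of_mem_shuffle : ∀ (u v : List ℕ) {x : List ℕ}, x ∈ shuffle u v → x.Perm (u ++ v)
  | [], v, x, h => by
    rw [shuffle_nil_left, Multiset.mem_singleton] at h
    subst h
    simp
  | a :: u, [], x, h => by
    rw [shuffle_nil_right, Multiset.mem_singleton] at h
    subst h
    simp
  | a :: u, b :: v, x, h => by
    rw [shuffle_cons, Multiset.mem_add, Multiset.mem_map, Multiset.mem_map] at h
    rcases h with ⟨y, hy, rfl⟩ | ⟨y, hy, rfl⟩
    · exact (perm_of_mem_shuffle u (b :: v) hy).cons a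
    · exact ((perm_of_mem_shuffle (a :: u) v hy).cons b).trans List.perm_middle.symm
  termination_by u v => u.length + v.length

theorem shuffle_map (f : ℕ → ℕ) : ∀ u v : List ℕ,
    shuffle (u.map f) (v.map f) = (shuffle u v).map (List.map f)
  | [], v => by simp [shuffle_nil_left]
  | a :: u, [] => by simp [shuffle_nil_right]
  | a :: u, b :: v => by
    have h1 := shuffle_map f u (b :: v)
    have h2 := shuffle_map f (a :: u) v
    simp only [List.map_cons] at h1 h2
    simp only [List.map_cons, shuffle_cons, h1, h2, Multiset.map_add, Multiset.map_map,
      Function.comp_def]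
  termination_by u v => u.length + v.length

theorem shuffle_assoc : ∀ u v w : List ℕ,
    (shuffle u v).bind (fun x => shuffle x w) = (shuffle v w).bind (fun y => shuffle u y)
  | [], v, w => by
    simp only [shuffle_nil_left, Multiset.singleton_bind]
    exact ((Multiset.bind_singleton _ id).trans (Multiset.map_id _)).symm
  | a :: u, [], w => by simp [shuffle_nil_left, shuffle_nil_right]
  | a :: u, b :: v, [] => by
    simp only [shuffle_nil_right, Multiset.singleton_bind]
    exact (Multiset.bind_singleton _ id).trans (Multiset.map_id _)
  | a :: u, b :: v, c :: w => by
    have h1 := shuffle_assoc u (b :: v) (c :: w)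
    have h2 := shuffle_assoc (a :: u) v (c :: w)
    have h3 := shuffle_assoc (a :: u) (b :: v) w
    have e1 : (shuffle (a :: u) (b :: v)).bind (fun x => shuffle x (c :: w)) =
        ((shuffle u (b :: v)).bind fun x => shuffle x (c :: w)).map (List.cons a) +
        ((shuffle (a :: u) v).bind fun x => shuffle x (c :: w)).map (List.cons b) +
        ((shuffle (a :: u) (b :: v)).bind fun x => shuffle x w).map (List.cons c) := by
      rw [shuffle_cons a b]
      simp only [Multiset.add_bind, Multiset.bind_map, shuffle_cons, Multiset.bind_add,
        ← Multiset.map_bind, Multiset.map_add]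
      abel
    have e2 : (shuffle (b :: v) (c :: w)).bind (fun y => shuffle (a :: u) y) =
        ((shuffle (b :: v) (c :: w)).bind fun y => shuffle u y).map (List.cons a) +
        ((shuffle v (c :: w)).bind fun y => shuffle (a :: u) y).map (List.cons b) +
        ((shuffle (b :: v) w).bind fun y => shuffle (a :: u) y).map (List.cons c) := by
      rw [shuffle_cons b c]
      simp only [Multiset.add_bind, Multiset.bind_map, shuffle_cons, Multiset.bind_add,
        ← Multiset.map_bind, Multiset.map_add]
      abel
    rw [e1, e2, h1, h2, h3]
  termination_by u v w => u.length + v.length + w.length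

theorem length_of_mem_shuffle {u v x : List ℕ} (h : x ∈ shuffle u v) :
    x.length = u.length + v.length := by
  simpa using (perm_of_mem_shuffle u v h).length_eq

/-- The shifted shuffle of two words, as a multiset of words. -/
def wordShiftedShuffle (u v : List ℕ) : Multiset (List ℕ) := shuffle u (shift u.length v)

theorem wordShiftedShuffle_assoc (u v w : List ℕ) :
    (wordShiftedShuffle u v).bind (fun x => wordShiftedShuffle x w) =
      (wordShiftedShuffle v w).bind (fun y => wordShiftedShuffle u y) := by
  have h : (wordShiftedShuffle u v).bind (fun x => wordShiftedShuffle x w) =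
      (shuffle u (shift u.length v)).bind
        (fun x => shuffle x (shift u.length (shift v.length w))) := by
    refine Multiset.bind_congr fun x hx => ?_
    have hl := length_of_mem_shuffle hx
    simp only [shift, List.length_map] at hl
    simp only [wordShiftedShuffle, shift, List.map_map, hl]
    congr 2
    funext i
    simp only [Function.comp]
    omega
  rw [h, shuffle_assoc]
  simp only [wordShiftedShuffle, shift]
  rw [shuffle_map, Multiset.bind_map]

theorem isPermWord_of_mem_wordShiftedShuffle {u v x : List ℕ} (hu : IsPermWord u)
    (hv : IsPermWord v) (hx : x ∈ wordShiftedShuffle u v) : IsPermWord x := by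
  have h := perm_of_mem_shuffle _ _ hx
  have hl := length_of_mem_shuffle hx
  simp only [shift, List.length_map] at hl
  unfold IsPermWord at *
  rw [hl, ← List.range'_append_1]
  refine h.trans (hu.append ?_)
  refine (hv.map _).trans (List.Perm.of_eq ?_)
  rw [show (fun i => i + u.length) = (fun i => u.length + i) from funext fun i => add_comm _ _,
    List.map_add_range', add_comm]

/-- The shifted shuffle of two permutations, as a multiset of permutations. -/
def shiftedShuffle (σ ν : SPerm) : Multiset SPerm :=
  (wordShiftedShuffle σ.1 ν.1).pmap Subtype.mk
    fun _ hx => isPermWord_of_mem_wordShiftedShuffle σ.2 ν.2 hx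

theorem map_val_shiftedShuffle (σ ν : SPerm) :
    (shiftedShuffle σ ν).map Subtype.val = wordShiftedShuffle σ.1 ν.1 := by
  simp [shiftedShuffle, Multiset.map_pmap, Multiset.pmap_eq_map]

theorem shiftedShuffle_assoc (σ ν ρ : SPerm) :
    (shiftedShuffle σ ν).bind (fun x => shiftedShuffle x ρ) =
      (shiftedShuffle ν ρ).bind (fun y => shiftedShuffle σ y) := by
  apply Multiset.map_injective Subtype.val_injective
  simp only [Multiset.map_bind, map_val_shiftedShuffle]
  have h := wordShiftedShuffle_assoc σ.1 ν.1 ρ.1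
  rw [← map_val_shiftedShuffle σ ν, ← map_val_shiftedShuffle ν ρ, Multiset.bind_map,
    Multiset.bind_map] at h
  exact h

theorem empty_shiftedShuffle (σ : SPerm) : shiftedShuffle SPerm.empty σ = {σ} := by
  apply Multiset.map_injective Subtype.val_injective
  rw [map_val_shiftedShuffle]
  simp [SPerm.empty, wordShiftedShuffle, shuffle_nil_left, shift]

theorem shiftedShuffle_empty (σ : SPerm) : shiftedShuffle σ SPerm.empty = {σ} := by
  apply Multiset.map_injective Subtype.val_injective
  rw [map_val_shiftedShuffle]
  simp [SPerm.empty, wordShiftedShuffle, shuffle_nil_right, shift]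

/-! ### The algebra `FQSym` of free quasi-symmetric functions -/

/-- The underlying vector space of `FQSym`: it has a basis indexed by all permutations. -/
def FQSym (K : Type*) [Field K] : Type _ := SPerm →₀ K

namespace FQSym

variable (K : Type*) [Field K]

noncomputable instance : AddCommGroup (FQSym K) := inferInstanceAs (AddCommGroup (SPerm →₀ K))

noncomputable instance : Module K (FQSym K) := inferInstanceAs (Module K (SPerm →₀ K))

/-- The fundamental basis. -/
noncomputable def F : Module.Basis SPerm K (FQSym K) := Finsupp.basisSingleOne

/-- The bilinear product with `F σ · F ν = ∑ F π`, for `π` in the shifted shuffle of `σ`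
and `ν`. -/
noncomputable def product : FQSym K →ₗ[K] FQSym K →ₗ[K] FQSym K :=
  (F K).constr K fun σ => (F K).constr K fun ν => ((shiftedShuffle σ ν).map (F K)).sum

theorem product_F (σ ν : SPerm) :
    product K (F K σ) (F K ν) = ((shiftedShuffle σ ν).map (F K)).sum := by
  simp only [product, Module.Basis.constr_basis]

theorem product_sum_left (s : Multiset SPerm) (ρ : SPerm) :
    product K ((s.map (F K)).sum) (F K ρ) =
      ((s.bind fun x => shiftedShuffle x ρ).map (F K)).sum := by
  induction s using Multiset.induction_on with
  | empty => simp
  | cons a s ih =>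
    simp [ih, product_F]

theorem product_sum_right (s : Multiset SPerm) (σ : SPerm) :
    product K (F K σ) ((s.map (F K)).sum) =
      ((s.bind fun y => shiftedShuffle σ y).map (F K)).sum := by
  induction s using Multiset.induction_on with
  | empty => simp
  | cons a s ih =>
    simp [ih, product_F]

variable {K} in
theorem induction_F {p : FQSym K → Prop} (hF : ∀ σ, p (F K σ)) (h0 : p 0)
    (hadd : ∀ x y, p x → p y → p (x + y)) (hsmul : ∀ (c : K) x, p x → p (c • x))
    (x : FQSym K) : p x := by
  have hx : x ∈ Submodule.span K (Set.range (F K)) := (F K).mem_span x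
  induction hx using Submodule.span_induction with
  | mem x h =>
    obtain ⟨σ, rfl⟩ := h
    exact hF σ
  | zero => exact h0
  | add x y _ _ hx hy => exact hadd x y hx hy
  | smul c x _ hx => exact hsmul c x hx

theorem product_assoc (x y z : FQSym K) :
    product K (product K x y) z = product K x (product K y z) := by
  induction x using induction_F with
  | hF σ =>
    induction y using induction_F with
    | hF ν =>
      induction z using induction_F with
      | hF ρ => rw [product_F, product_F, product_sum_left, product_sum_right, shiftedShuffle_assoc]
      | h0 => simp
      | hadd x y hx hy => simp only [map_add, hx, hy]
      | hsmul c x hx => simp only [map_smul, hx]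
    | h0 => simp
    | hadd x y hx hy => simp only [map_add, LinearMap.add_apply, hx, hy]
    | hsmul c x hx => simp only [map_smul, LinearMap.smul_apply, hx]
  | h0 => simp
  | hadd x y hx hy => simp only [map_add, LinearMap.add_apply, hx, hy]
  | hsmul c x hx => simp only [map_smul, LinearMap.smul_apply, hx]

theorem F_empty_product (x : FQSym K) : product K (F K SPerm.empty) x = x := by
  induction x using induction_F with
  | hF σ => simp [product_F, empty_shiftedShuffle]
  | h0 => simp
  | hadd x y hx hy => simp only [map_add, hx, hy]
  | hsmul c x hx => simp only [map_smul, hx]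

theorem product_F_empty (x : FQSym K) : product K x (F K SPerm.empty) = x := by
  induction x using induction_F with
  | hF σ => simp [product_F, shiftedShuffle_empty]
  | h0 => simp
  | hadd x y hx hy => simp only [map_add, LinearMap.add_apply, hx, hy]
  | hsmul c x hx => simp only [map_smul, LinearMap.smul_apply, hx]

noncomputable instance : Ring (FQSym K) :=
  { (inferInstance : AddCommGroup (FQSym K)) with
    mul := fun x y => product K x y
    one := F K SPerm.empty
    mul_assoc := product_assoc K
    one_mul := F_empty_product K
    mul_one := product_F_empty K
    left_distrib := fun x y z => map_add (product K x) y z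
    right_distrib := fun x y z => LinearMap.map_add₂ (product K) x y z
    zero_mul := fun x => LinearMap.map_zero₂ (product K) x
    mul_zero := fun x => map_zero (product K x) }

noncomputable instance : Algebra K (FQSym K) :=
  Algebra.ofModule (fun c x y => LinearMap.map_smul₂ (product K) c x y)
    (fun c x y => map_smul (product K x) c y)

theorem F_mul_F (σ ν : SPerm) : F K σ * F K ν = ((shiftedShuffle σ ν).map (F K)).sum :=
  product_F K σ ν

theorem one_eq_F : (1 : FQSym K) = F K SPerm.empty := rfl

end FQSym

/-! ### Pairs of twin binary trees -/

/-- The leaves of a binary tree from left to right: `false` (written `0` in the canopy) for a leaf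
that is a right child and `true` (written `1`) for a leaf that is a left child. The first argument
is the orientation of the root, used when the tree is itself a leaf. -/
def leafWord : Bool → BinaryTree Unit → List Bool
  | o, .nil => [o]
  | _, .node _ l r => leafWord true l ++ leafWord false r

/-- The canopy of a binary tree: the orientations of its leaves, except the first and the last. -/
def canopy (T : BinaryTree Unit) : List Bool := (leafWord true T).tail.dropLast

/-- Two binary trees with the same number of nodes are twins when their canopies are
complementary. -/
def IsTwin (J : BinaryTree Unit × BinaryTree Unit) : Prop :=
  J.1.numNodes = J.2.numNodes ∧ canopy J.2 = (canopy J.1).map (fun b => !b)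

instance : DecidablePred IsTwin := fun J => by unfold IsTwin; infer_instance

/-- Pairs `(T_L, T_R)` of twin binary trees. -/
abbrev TBT : Type := {J : BinaryTree Unit × BinaryTree Unit // IsTwin J}

/-- The number of nodes of each tree of the pair. -/
def TBT.size (J : TBT) : ℕ := J.1.1.numNodes

/-- The finite set of pairs of twin binary trees in which each tree has `n` nodes. -/
def twinsOfSize (n : ℕ) : Finset TBT :=
  (BinaryTree.treesOfNumNodesEq n ×ˢ BinaryTree.treesOfNumNodesEq n).subtype IsTwin

theorem mem_twinsOfSize {n : ℕ} {J : TBT} : J ∈ twinsOfSize n ↔ J.size = n := by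
  have h := J.2.1
  simp only [twinsOfSize, Finset.mem_subtype, Finset.mem_product,
    BinaryTree.mem_treesOfNumNodesEq, TBT.size]
  omega

/-- Leaf insertion of a letter into a left binary search tree. -/
def leafInsert (a : ℕ) : BinaryTree ℕ → BinaryTree ℕ
  | .nil => .node a .nil .nil
  | .node b l r => if a < b then .node b (leafInsert a l) r else .node b l (leafInsert a r)

/-- The lower restricted binary tree `T_{≤ b}` of a right binary search tree. -/
def lowerRestrict (b : ℕ) : BinaryTree ℕ → BinaryTree ℕ
  | .nil => .nil
  | .node a l r =>
    if a ≤ b then .node a (lowerRestrict b l) (lowerRestrict b r) else lowerRestrict b l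

/-- The higher restricted binary tree `T_{> b}` of a right binary search tree. -/
def higherRestrict (b : ℕ) : BinaryTree ℕ → BinaryTree ℕ
  | .nil => .nil
  | .node a l r =>
    if b < a then .node a (higherRestrict b l) (higherRestrict b r) else higherRestrict b r

/-- Root insertion of a letter into a right binary search tree. -/
def rootInsert (a : ℕ) (T : BinaryTree ℕ) : BinaryTree ℕ :=
  .node a (lowerRestrict a T) (higherRestrict a T)

/-- The `ℙ`-symbol of a word: its letters are inserted, from left to right, into the pair of empty
trees, by leaf insertion on the left and by root insertion on the right. -/
def pSymbol (w : List ℕ) : BinaryTree ℕ × BinaryTree ℕ :=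
  w.foldl (fun T a => (leafInsert a T.1, rootInsert a T.2)) (.nil, .nil)

/-- The shape of the `ℙ`-symbol: the labels are forgotten. -/
def pShape (w : List ℕ) : BinaryTree Unit × BinaryTree Unit :=
  ((pSymbol w).1.map fun _ => (), (pSymbol w).2.map fun _ => ())

/-- The order on pairs of twin binary trees that is induced by the permutohedron order. -/
def TBT.LE (J₀ J₁ : TBT) : Prop :=
  ∃ σ₀ σ₁ : SPerm, pShape σ₀.1 = J₀.1 ∧ pShape σ₁.1 = J₁.1 ∧ σ₀.PermLE σ₁

/-- A pair of twin binary trees is connected if the (unique) Baxter permutation with this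
`ℙ`-symbol is connected. -/
def TBT.IsConnected (J : TBT) : Prop :=
  ∃ σ : SPerm, σ.IsBaxter ∧ pShape σ.1 = J.1 ∧ σ.IsConnected

/-! ### The algebra `Baxter` -/

variable (K : Type*) [Field K]

/-- `P_J` is the sum of the `F_σ` over the permutations `σ` whose `ℙ`-symbol is `J`. -/
noncomputable def P (J : TBT) : FQSym K :=
  ∑ σ ∈ permsOfSize J.size with pShape σ.1 = J.1, FQSym.F K σ

open Classical in
/-- The elementary element `E_J` is the sum of the `P_{J'}` over the `J' ≥ J`. -/
noncomputable def E (J : TBT) : FQSym K :=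
  ∑ J' ∈ twinsOfSize J.size with J.LE J', P K J'

/-- The underlying vector space of `Baxter`: the span in `FQSym` of the family `P_J`. -/
noncomputable def baxterSpan : Submodule K (FQSym K) := Submodule.span K (Set.range (P K))

end BaxterAlgebra

/-!
The proof goes through the multiplicative basis of `FQSym`. For a permutation `σ`, let `upperSum σ`
be the sum of the `F ν` over the permutations `ν ≥ σ` of the permutohedron. This family is
unitriangular with respect to the basis `F`, hence linearly independent, and it is multiplicative:
the inversions of `σ ⟋ τ` being those of its two factors, the permutations above `σ ⟋ τ` are
exactly the shifted shuffles of one above `σ` and one above `τ`, so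
`upperSum σ * upperSum τ = upperSum (σ ⟋ τ)` (`upperSum_mul`). Factorization of permutations into
connected ones is unique (`SPerm.IsConnected.slash_inj`).

It remains to see that `Baxter` is spanned by the `upperSum μ` for a set of permutations `μ` stable
under `⟋` and under taking factors. In the binary search tree grown by leaf insertion, `x` is an
ancestor of `y` when `x` occurs first among the letters with value between `x` and `y`; root
insertion does the same for the last letters. Thus two permutations have the same `ℙ`-symbol iff
the same letters are first and last in the intervals of values that they bound (`Sim`,
`pShape_eq_iff`). Each class contains a permutation in which no adjacent descent `d a` has
intermediate values on both sides (`Bottom`), since otherwise `d` and `a` may be exchanged. In such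
a permutation, every inversion is a consequence, by transitivity, of inversions `d … a` for which
`d` is first or `a` is last among the values from `a` to `d` (`Bottom.first_or_last`). These
conditions are invariant within the classes and persist upwards in the permutohedron, so `μ` is the
minimum of its class and the passage to the minimum is increasing (`Bottom.invLE_of_sim`).
Therefore `E_J = upperSum μ` for the minimum `μ` of the class `J` (`E_twins`), and these elements
span `Baxter` by triangularity (`baxterSpan_eq`).

Finally, connectedness of `J` is defined through the Baxter permutation of the class and not
through its minimum. Each class contains a Baxter permutation (`exists_wordBaxter`, by insertion of
the largest letter), and it has the same splitting positions as the minimum (`WordBaxter.split`):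
at two adjacent letters `d > k ≥ a` of a Baxter permutation, the first and the last letter with
value from `a` to `d` would form with them a pattern `2413` if an equivalent permutation were split
at `k`.
-/

namespace BaxterAlgebra

/-! ### Relative order of the letters of a word -/

/-- The letter `x` occurs before the letter `y` in the word `w`. -/
def Before (w : List ℕ) (x y : ℕ) : Prop := [x, y].Sublist w

instance (w : List ℕ) (x y : ℕ) : Decidable (Before w x y) := by
  unfold Before; infer_instance

theorem not_before_nil (x y : ℕ) : ¬ Before [] x y := by
  simp [Before]

theorem before_cons {a : ℕ} {u : List ℕ} {x y : ℕ} :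
    Before (a :: u) x y ↔ (x = a ∧ y ∈ u) ∨ Before u x y := by
  unfold Before
  rw [List.sublist_cons_iff]
  constructor
  · rintro (h | ⟨r, hr, h⟩)
    · exact Or.inr h
    · simp only [List.cons.injEq] at hr
      obtain ⟨rfl, rfl⟩ := hr
      exact Or.inl ⟨rfl, by simpa using h⟩
  · rintro (⟨rfl, h⟩ | h)
    · exact Or.inr ⟨[y], rfl, by simpa using h⟩
    · exact Or.inl h

theorem Before.mem_left {w : List ℕ} {x y : ℕ} (h : Before w x y) : x ∈ w :=
  h.subset (by simp)

theorem Before.mem_right {w : List ℕ} {x y : ℕ} (h : Before w x y) : y ∈ w :=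
  h.subset (by simp)

theorem before_append {u v : List ℕ} {x y : ℕ} :
    Before (u ++ v) x y ↔ Before u x y ∨ Before v x y ∨ (x ∈ u ∧ y ∈ v) := by
  induction u with
  | nil => simp [not_before_nil]
  | cons a u ih =>
    simp only [List.cons_append, before_cons, ih, List.mem_append, List.mem_cons]
    tauto

theorem before_reverse {w : List ℕ} {x y : ℕ} : Before w.reverse x y ↔ Before w y x := by
  unfold Before
  rw [← List.reverse_sublist]
  simp

theorem before_filter {w : List ℕ} {p : ℕ → Bool} {x y : ℕ} :
    Before (w.filter p) x y ↔ Before w x y ∧ p x = true ∧ p y = true := by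
  induction w with
  | nil => simp [not_before_nil]
  | cons a u ih =>
    by_cases h : p a = true
    · rw [List.filter_cons_of_pos h, before_cons, before_cons, ih, List.mem_filter]
      constructor
      · rintro (⟨rfl, h1, h2⟩ | h1)
        · exact ⟨Or.inl ⟨rfl, h1⟩, h, h2⟩
        · tauto
      · tauto
    · rw [List.filter_cons_of_neg h, before_cons, ih]
      constructor
      · tauto
      · rintro ⟨⟨rfl, -⟩ | h1, h2⟩
        · exact absurd h2.1 h
        · exact ⟨h1, h2⟩

theorem Before.asymm {w : List ℕ} (hw : w.Nodup) {x y : ℕ} (h : Before w x y) :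
    ¬ Before w y x := by
  induction w with
  | nil => exact absurd h (not_before_nil _ _)
  | cons a u ih =>
    rw [List.nodup_cons] at hw
    rw [before_cons] at h ⊢
    rintro (⟨rfl, h1⟩ | h1)
    · rcases h with ⟨rfl, h2⟩ | h2
      · exact hw.1 h2
      · exact hw.1 h2.mem_right
    · rcases h with ⟨rfl, h2⟩ | h2
      · exact hw.1 h1.mem_right
      · exact ih hw.2 h2 h1

theorem Before.ne {w : List ℕ} (hw : w.Nodup) {x y : ℕ} (h : Before w x y) : x ≠ y := by
  rintro rfl
  exact h.asymm hw h

theorem Before.trans {w : List ℕ} (hw : w.Nodup) {x y z : ℕ} (h : Before w x y)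
    (h' : Before w y z) : Before w x z := by
  induction w with
  | nil => exact absurd h (not_before_nil _ _)
  | cons a u ih =>
    rw [List.nodup_cons] at hw
    rw [before_cons] at h h' ⊢
    rcases h with ⟨rfl, h1⟩ | h1
    · rcases h' with ⟨rfl, h2⟩ | h2
      · exact absurd h1 hw.1
      · exact Or.inl ⟨rfl, h2.mem_right⟩
    · rcases h' with ⟨rfl, h2⟩ | h2
      · exact absurd h1.mem_right hw.1
      · exact Or.inr (ih hw.2 h1 h2)

theorem before_total {w : List ℕ} {x y : ℕ} (hx : x ∈ w) (hy : y ∈ w) (hxy : x ≠ y) :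
    Before w x y ∨ Before w y x := by
  induction w with
  | nil => simp at hx
  | cons a u ih =>
    simp only [before_cons]
    rw [List.mem_cons] at hx hy
    rcases hx with rfl | hx <;> rcases hy with rfl | hy
    · exact absurd rfl hxy
    · tauto
    · tauto
    · have := ih hx hy
      tauto

theorem not_before_iff {w : List ℕ} (hw : w.Nodup) {x y : ℕ} (hx : x ∈ w) (hy : y ∈ w)
    (hxy : x ≠ y) : ¬ Before w x y ↔ Before w y x :=
  ⟨fun h => (before_total hx hy hxy).resolve_left h, fun h => h.asymm hw⟩

theorem before_middle {w X Y : List ℕ} {a y : ℕ} (hw : w.Nodup) (e : w = X ++ a :: Y) :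
    Before w a y ↔ y ∈ Y := by
  rw [e, List.nodup_middle, List.nodup_cons, List.mem_append] at hw
  rw [e, before_append, before_cons]
  constructor
  · rintro (h | (⟨-, h⟩ | h) | ⟨h, -⟩)
    · exact absurd (Or.inl h.mem_left) hw.1
    · exact h
    · exact absurd (Or.inr h.mem_left) hw.1
    · exact absurd (Or.inl h) hw.1
  · tauto

theorem before_middle' {w X Y : List ℕ} {a y : ℕ} (hw : w.Nodup) (e : w = X ++ a :: Y) :
    Before w y a ↔ y ∈ X := by
  have := before_middle (w := w.reverse) (X := Y.reverse) (Y := X.reverse) (a := a) (y := y)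
    (List.nodup_reverse.2 hw) (by simp [e])
  simpa [before_reverse] using this

/-- A word without repeated letters is determined by its letters and their relative order. -/
theorem eq_of_before_imp {w w' : List ℕ} (hw : w.Nodup) (hp : w.Perm w')
    (h : ∀ x y, Before w x y → Before w' x y) : w = w' := by
  induction w generalizing w' with
  | nil => simpa using hp
  | cons a u ih =>
    cases w' with
    | nil => simp at hp
    | cons b v =>
      have hw' := hp.nodup_iff.1 hw
      have hab : a = b := by
        by_contra hne
        have hb : b ∈ u := by
          have : b ∈ a :: u := hp.mem_iff.2 (by simp)
          rw [List.mem_cons] at this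
          exact this.resolve_left (Ne.symm hne)
        have h1 := h a b (before_cons.2 (Or.inl ⟨rfl, hb⟩))
        exact (h1.asymm hw') (before_cons.2 (Or.inl ⟨rfl, by
          have : a ∈ b :: v := h1.mem_left
          rw [List.mem_cons] at this
          exact this.resolve_left hne⟩))
      subst hab
      rw [List.nodup_cons] at hw hw'
      congr 1
      refine ih hw.2 ((List.perm_cons a).1 hp) fun x y hxy => ?_
      have h1 := h x y (before_cons.2 (Or.inr hxy))
      rw [before_cons] at h1
      rcases h1 with ⟨rfl, -⟩ | h1
      · exact absurd hxy.mem_left hw.1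
      · exact h1

/-- If the order of the letters differs between two words with the same letters, then two letters
that are adjacent in the second word are ordered differently by the first one. -/
theorem exists_adjacent_of_ne {w w' : List ℕ} (hw : w.Nodup) (hp : w.Perm w') (hne : w ≠ w') :
    ∃ X Y b a, w' = X ++ b :: a :: Y ∧ Before w a b := by
  by_contra hcon
  push Not at hcon
  refine hne (eq_of_before_imp (hp.nodup_iff.1 hw) hp.symm ?_).symm
  have hmem : ∀ x, x ∈ w' → x ∈ w := fun x => hp.mem_iff.2
  have hw' := hp.nodup_iff.1 hw
  clear hne hp
  induction w' with
  | nil => exact fun x y h => absurd h (not_before_nil _ _)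
  | cons b v ih =>
    have ih' := ih (fun X Y c a e => hcon (b :: X) Y c a (by simp [e]))
      (fun x hx => hmem x (by simp [hx])) (List.nodup_cons.1 hw').2
    intro x y hxy
    rw [before_cons] at hxy
    rcases hxy with ⟨rfl, hy⟩ | h
    · cases v with
      | nil => simp at hy
      | cons c v =>
        have h1 : Before w x c := by
          have := hcon [] v x c rfl
          refine (before_total (hmem x (by simp)) (hmem c (by simp)) ?_).resolve_right this
          rintro rfl
          simp at hw'
        rw [List.mem_cons] at hy
        rcases hy with rfl | hy
        · exact h1
        · exact h1.trans hw (ih' c y (before_cons.2 (Or.inl ⟨rfl, hy⟩)))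
    · exact ih' x y h

/-- The letter `x` precedes all the other letters of `w` whose value lies between `x` and `y`. -/
def First (w : List ℕ) (x y : ℕ) : Prop :=
  ∀ z ∈ w, z ≠ x → min x y ≤ z → z ≤ max x y → Before w x z

/-- The letter `x` follows all the other letters of `w` whose value lies between `x` and `y`. -/
def Last (w : List ℕ) (x y : ℕ) : Prop :=
  ∀ z ∈ w, z ≠ x → min x y ≤ z → z ≤ max x y → Before w z x

theorem first_reverse {w : List ℕ} {x y : ℕ} : First w.reverse x y ↔ Last w x y := by
  simp [First, Last, before_reverse]

theorem last_reverse {w : List ℕ} {x y : ℕ} : Last w.reverse x y ↔ First w x y := by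
  simp [First, Last, before_reverse]

/-! ### The trees of the `ℙ`-symbol -/

/-- The binary search tree obtained by leaf insertion of the letters of `w` from left to right. -/
def leafTree (w : List ℕ) : BinaryTree ℕ := w.foldl (fun T a => leafInsert a T) .nil

/-- The binary search tree obtained by root insertion of the letters of `w` from left to right. -/
def rootTree (w : List ℕ) : BinaryTree ℕ := w.foldl (fun T a => rootInsert a T) .nil

theorem pSymbol_eq (w : List ℕ) : pSymbol w = (leafTree w, rootTree w) := by
  have : ∀ (w : List ℕ) (T T' : BinaryTree ℕ),
      w.foldl (fun (T : BinaryTree ℕ × BinaryTree ℕ) a => (leafInsert a T.1, rootInsert a T.2))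
        (T, T') =
      (w.foldl (fun T a => leafInsert a T) T, w.foldl (fun T a => rootInsert a T) T') := by
    intro w
    induction w with
    | nil => simp
    | cons a w ih => intro T T'; simp [ih]
  exact this w _ _

theorem foldl_leafInsert_node (a : ℕ) (u : List ℕ) (l r : BinaryTree ℕ) :
    u.foldl (fun T a => leafInsert a T) (.node a l r) =
      .node a ((u.filter (· < a)).foldl (fun T a => leafInsert a T) l)
        ((u.filter (a ≤ ·)).foldl (fun T a => leafInsert a T) r) := by
  induction u generalizing l r with
  | nil => simp
  | cons b u ih =>
    rw [List.foldl_cons]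
    by_cases h : b < a
    · simp [leafInsert, h, ih]
    · simp [leafInsert, h, ih, not_lt.1 h]

theorem leafTree_cons (a : ℕ) (u : List ℕ) : leafTree (a :: u) =
    .node a (leafTree (u.filter (· < a))) (leafTree (u.filter (a ≤ ·))) := by
  unfold leafTree
  rw [List.foldl_cons, leafInsert, foldl_leafInsert_node]

theorem rootTree_append (u : List ℕ) (a : ℕ) : rootTree (u ++ [a]) = rootInsert a (rootTree u) := by
  simp [rootTree]

theorem restrict_rootTree (n : ℕ) : ∀ u : List ℕ, u.length ≤ n → ∀ b : ℕ,
    lowerRestrict b (rootTree u) = rootTree (u.filter (· ≤ b)) ∧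
      higherRestrict b (rootTree u) = rootTree (u.filter (b < ·)) := by
  induction n with
  | zero =>
    intro u hu b
    obtain rfl : u = [] := by simpa using hu
    simp [rootTree, lowerRestrict, higherRestrict]
  | succ n ih =>
    intro u hu b
    rcases List.eq_nil_or_concat u with rfl | ⟨v, a, rfl⟩
    · simp [rootTree, lowerRestrict, higherRestrict]
    have hv : v.length ≤ n := by simpa using hu
    have hlow : ∀ c, (v.filter (· ≤ c)).length ≤ n :=
      fun c => (List.length_filter_le _ _).trans hv
    have hhigh : ∀ c, (v.filter (c < ·)).length ≤ n :=
      fun c => (List.length_filter_le _ _).trans hv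
    rw [List.concat_eq_append, rootTree_append, rootInsert, (ih v hv a).1, (ih v hv a).2]
    constructor
    · by_cases h : a ≤ b
      · rw [lowerRestrict, if_pos h, (ih _ (hlow a) b).1, (ih _ (hhigh a) b).1]
        rw [List.filter_append, List.filter_singleton, decide_eq_true h, cond_true, rootTree_append,
          rootInsert, (ih _ (hlow b) a).1, (ih _ (hlow b) a).2]
        simp only [List.filter_filter]
        refine congrArg₂ (BinaryTree.node a) (congrArg rootTree (List.filter_congr fun x _ => ?_))
          (congrArg rootTree (List.filter_congr fun x _ => ?_)) <;>
          rw [Bool.eq_iff_iff] <;> simp <;> omega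
      · rw [lowerRestrict, if_neg h, (ih _ (hlow a) b).1]
        rw [List.filter_append, List.filter_singleton, decide_eq_false h, cond_false,
          List.append_nil]
        simp only [List.filter_filter]
        refine congrArg rootTree (List.filter_congr fun x _ => ?_)
        rw [Bool.eq_iff_iff]; simp; omega
    · by_cases h : b < a
      · rw [higherRestrict, if_pos h, (ih _ (hlow a) b).2, (ih _ (hhigh a) b).2]
        rw [List.filter_append, List.filter_singleton, decide_eq_true h, cond_true, rootTree_append,
          rootInsert, (ih _ (hhigh b) a).1, (ih _ (hhigh b) a).2]
        simp only [List.filter_filter]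
        refine congrArg₂ (BinaryTree.node a) (congrArg rootTree (List.filter_congr fun x _ => ?_))
          (congrArg rootTree (List.filter_congr fun x _ => ?_)) <;>
          rw [Bool.eq_iff_iff] <;> simp <;> omega
      · rw [higherRestrict, if_neg h, (ih _ (hhigh a) b).2]
        rw [List.filter_append, List.filter_singleton, decide_eq_false h, cond_false,
          List.append_nil]
        simp only [List.filter_filter]
        refine congrArg rootTree (List.filter_congr fun x _ => ?_)
        rw [Bool.eq_iff_iff]; simp; omega

/-- Root insertion builds the same tree as leaf insertion of the reversed word. -/
theorem rootTree_eq_leafTree_reverse : ∀ w : List ℕ, w.Nodup → rootTree w = leafTree w.reverse := by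
  intro w
  induction hn : w.length using Nat.strong_induction_on generalizing w with
  | _ n ih =>
    intro hw
    rcases List.eq_nil_or_concat w with rfl | ⟨v, a, rfl⟩
    · rfl
    rw [List.concat_eq_append] at hw hn ⊢
    have hv : v.Nodup := hw.sublist (by simp)
    have ha : ∀ x ∈ v, x ≠ a := by
      rintro x hx rfl
      exact (List.nodup_append.1 hw).2.2 x hx x (by simp) rfl
    have hl : ∀ p : ℕ → Bool, (v.filter p).length < n := by
      intro p
      have := List.length_filter_le p v
      simp at hn
      omega
    rw [rootTree_append, rootInsert, List.reverse_append, List.reverse_singleton,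
      List.singleton_append, leafTree_cons, (restrict_rootTree _ v le_rfl a).1,
      (restrict_rootTree _ v le_rfl a).2, ih _ (hl _) _ rfl (hv.filter _),
      ih _ (hl _) _ rfl (hv.filter _), List.filter_reverse, List.filter_reverse]
    congr 3
    · refine List.filter_congr fun x hx => ?_
      have := ha x hx
      simp; omega
    · refine List.filter_congr fun x hx => ?_
      have := ha x hx
      simp; omega

theorem numNodes_leafTree (w : List ℕ) : (leafTree w).numNodes = w.length := by
  induction hn : w.length using Nat.strong_induction_on generalizing w with
  | _ n ih =>
    cases w with
    | nil => simpa [leafTree, BinaryTree.numNodes] using hn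
    | cons a u =>
      simp only [List.length_cons] at hn
      have h1 := List.length_filter_le (· < a) u
      have h2 := List.length_filter_le (a ≤ ·) u
      have h3 := List.length_eq_length_filter_add (l := u) (fun x => decide (x < a))
      have h4 : (fun x => !decide (x < a)) = fun x => decide (a ≤ x) := by
        ext x; rw [← decide_not, decide_eq_decide]; exact not_lt
      rw [h4] at h3
      rw [leafTree_cons, BinaryTree.numNodes, ih _ (by omega) _ rfl, ih _ (by omega) _ rfl]
      omega

theorem numNodes_map {α β : Type*} (f : α → β) (T : BinaryTree α) :
    (T.map f).numNodes = T.numNodes := by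
  induction T with
  | nil => rfl
  | node a l r hl hr => simp [BinaryTree.map, BinaryTree.numNodes, hl, hr]

theorem first_cons_iff {a : ℕ} {u : List ℕ} (hu : (a :: u).Nodup) {x y : ℕ} :
    First (a :: u) x y ↔ x = a ∨
      (x < a ∧ y < a ∧ First (u.filter (· < a)) x y) ∨
      (a < x ∧ a < y ∧ First (u.filter (a ≤ ·)) x y) := by
  rw [List.nodup_cons] at hu
  simp only [First, before_cons, before_filter, List.mem_filter, List.mem_cons, decide_eq_true_eq]
  constructor
  · intro h
    by_cases hxa : x = a
    · exact Or.inl hxa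
    by_cases hb : min x y ≤ a ∧ a ≤ max x y
    · rcases h a (Or.inl rfl) (Ne.symm hxa) hb.1 hb.2 with h1 | h1
      · exact Or.inl h1.1
      · exact absurd h1.mem_right hu.1
    · refine Or.inr ?_
      have h' : ∀ z ∈ u, z ≠ x → min x y ≤ z → z ≤ max x y → Before u x z := by
        intro z hz hzx h1 h2
        rcases h z (Or.inr hz) hzx h1 h2 with h3 | h3
        · exact absurd h3.1 hxa
        · exact h3
      by_cases hlt : x < a ∧ y < a
      · refine Or.inl ⟨hlt.1, hlt.2, fun z hz hzx h1 h2 => ⟨h' z hz.1 hzx h1 h2, hlt.1, hz.2⟩⟩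
      · refine Or.inr ⟨by omega, by omega, fun z hz hzx h1 h2 =>
          ⟨h' z hz.1 hzx h1 h2, by omega, hz.2⟩⟩
  · rintro (rfl | ⟨hx, hy, h⟩ | ⟨hx, hy, h⟩) z hz hzx h1 h2
    · exact Or.inl ⟨rfl, hz.resolve_left hzx⟩
    · have hz' : z ∈ u := hz.resolve_left (by omega)
      exact Or.inr (h z ⟨hz', by omega⟩ hzx h1 h2).1
    · have hz' : z ∈ u := hz.resolve_left (by omega)
      exact Or.inr (h z ⟨hz', by omega⟩ hzx h1 h2).1

/-- The shape of the leaf insertion tree records exactly which letters come first in the intervals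
of values of which they are an end: these are the ancestor relations of the tree. -/
theorem map_leafTree_eq_iff {w w' : List ℕ} (hw : w.Nodup) (hp : w.Perm w') :
    (leafTree w).map (fun _ => ()) = (leafTree w').map (fun _ => ()) ↔
      ∀ x ∈ w, ∀ y ∈ w, First w x y ↔ First w' x y := by
  induction hn : w.length using Nat.strong_induction_on generalizing w w' with
  | _ n ih =>
    have hw' := hp.nodup_iff.1 hw
    cases w with
    | nil =>
      obtain rfl : w' = [] := by simpa using hp.symm
      simp
    | cons a u =>
      cases w' with
      | nil => simp at hp
      | cons b v =>
        simp only [List.length_cons] at hn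
        have hl : ∀ p : ℕ → Bool, (u.filter p).length < n := by
          intro p
          have := List.length_filter_le p u
          omega
        -- The root of the tree is the first letter; the two words have the same first letter.
        have key : a = b → ((leafTree (a :: u)).map (fun _ => ()) =
            (leafTree (b :: v)).map (fun _ => ()) ↔
            ∀ x ∈ a :: u, ∀ y ∈ a :: u, First (a :: u) x y ↔ First (b :: v) x y) := by
          rintro rfl
          have hp' := (List.perm_cons a).1 hp
          have i1 := ih _ (hl (· < a)) (hw.of_cons.filter _) (hp'.filter _) rfl
          have i2 := ih _ (hl (a ≤ ·)) (hw.of_cons.filter _) (hp'.filter _) rfl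
          simp only [leafTree_cons, BinaryTree.map, BinaryTree.node.injEq, true_and]
          rw [i1, i2]
          simp only [first_cons_iff hw, first_cons_iff hw', List.mem_filter, decide_eq_true_eq]
          rw [List.nodup_cons] at hw
          constructor
          · rintro ⟨h1, h2⟩ x hx y hy
            by_cases hxa : x = a
            · simp [hxa]
            have hx' : x ∈ u := (List.mem_cons.1 hx).resolve_left hxa
            by_cases hya : y = a
            · subst hya; simp [hxa]
            have hy' : y ∈ u := (List.mem_cons.1 hy).resolve_left hya
            by_cases hxl : x < a <;> by_cases hyl : y < a
            · have := h1 x ⟨hx', hxl⟩ y ⟨hy', hyl⟩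
              have e : ¬ a < x := by omega
              simp [hxa, hxl, hyl, e, this]
            · have e : ¬ a < x := by omega
              simp [hxa, hyl, e]
            · have e : ¬ a < y := by omega
              simp [hxa, hxl, e]
            · have := h2 x ⟨hx', by omega⟩ y ⟨hy', by omega⟩
              simp [hxa, hxl, hyl, this]
          · intro h
            constructor
            · rintro x ⟨hx, hxa⟩ y ⟨hy, hya⟩
              have := h x (by simp [hx]) y (by simp [hy])
              have e1 : x ≠ a := by omega
              have e2 : ¬ a < x := by omega
              simpa [hxa, hya, e1, e2] using this
            · rintro x ⟨hx, hxa⟩ y ⟨hy, hya⟩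
              have hx' : x ≠ a := by rintro rfl; exact hw.1 hx
              have hy' : y ≠ a := by rintro rfl; exact hw.1 hy
              have := h x (by simp [hx]) y (by simp [hy])
              have e1 : ¬ x < a := by omega
              have e2 : a < x := by omega
              have e3 : a < y := by omega
              simpa [hx', e1, e2, e3] using this
        constructor
        · intro h
          refine (key ?_).1 h
          simp only [leafTree_cons, BinaryTree.map, BinaryTree.node.injEq, true_and] at h
          have h1 := congrArg BinaryTree.numNodes h.1
          rw [numNodes_map, numNodes_map, numNodes_leafTree, numNodes_leafTree] at h1
          -- The same number of letters lie below the two roots.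
          have e1 : ((a :: u).filter (· < a)).length = ((a :: u).filter (· < b)).length := by
            rw [(hp.filter (· < b)).length_eq]
            simpa using h1
          have aux : ∀ {c d : ℕ}, c ∈ a :: u → c < d →
              ((a :: u).filter (· < c)).length < ((a :: u).filter (· < d)).length := by
            intro c d hc hcd
            have hs : ((a :: u).filter (· < c)).Sublist ((a :: u).filter (· < d)) :=
              List.monotone_filter_right _ fun x hx => by
                simp only [decide_eq_true_eq] at hx ⊢; omega
            refine lt_of_le_of_ne hs.length_le fun he => ?_
            have := hs.eq_of_length he
            have hc' : c ∈ (a :: u).filter (· < d) := by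
              rw [List.mem_filter]; exact ⟨hc, by simpa using hcd⟩
            rw [← this] at hc'
            simp at hc'
          by_contra hab
          rcases lt_or_gt_of_ne hab with hlt | hlt
          · have := aux (by simp) hlt; omega
          · have := aux (hp.mem_iff.2 (by simp)) hlt; omega
        · intro h
          refine (key ?_).2 h
          by_contra hab
          have hb : b ∈ a :: u := hp.mem_iff.2 (by simp)
          have h1 := (h a (by simp) b hb).1 ((first_cons_iff hw).2 (Or.inl rfl))
          rw [first_cons_iff hw'] at h1
          omega

/-- Two words are equivalent when they have the same letters and the same letters come first, and
last, in the intervals of values of which they are an end. -/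
structure Sim (w w' : List ℕ) : Prop where
  perm : w.Perm w'
  first : ∀ x ∈ w, ∀ y ∈ w, First w x y ↔ First w' x y
  last : ∀ x ∈ w, ∀ y ∈ w, Last w x y ↔ Last w' x y

theorem Sim.symm {w w' : List ℕ} (h : Sim w w') : Sim w' w :=
  ⟨h.perm.symm, fun x hx y hy => (h.first x (h.perm.mem_iff.2 hx) y (h.perm.mem_iff.2 hy)).symm,
    fun x hx y hy => (h.last x (h.perm.mem_iff.2 hx) y (h.perm.mem_iff.2 hy)).symm⟩

theorem Sim.refl (w : List ℕ) : Sim w w :=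
  ⟨List.Perm.refl _, fun _ _ _ _ => Iff.rfl, fun _ _ _ _ => Iff.rfl⟩

theorem Sim.trans {w w' w'' : List ℕ} (h : Sim w w') (h' : Sim w' w'') : Sim w w'' :=
  ⟨h.perm.trans h'.perm,
    fun x hx y hy => (h.first x hx y hy).trans
      (h'.first x (h.perm.mem_iff.1 hx) y (h.perm.mem_iff.1 hy)),
    fun x hx y hy => (h.last x hx y hy).trans
      (h'.last x (h.perm.mem_iff.1 hx) y (h.perm.mem_iff.1 hy))⟩

theorem Sim.reverse {w w' : List ℕ} (h : Sim w w') : Sim w.reverse w'.reverse :=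
  ⟨(List.reverse_perm _).trans (h.perm.trans (List.reverse_perm _).symm),
    fun x hx y hy => by
      rw [first_reverse, first_reverse]
      exact h.last x (List.mem_reverse.1 hx) y (List.mem_reverse.1 hy),
    fun x hx y hy => by
      rw [last_reverse, last_reverse]
      exact h.first x (List.mem_reverse.1 hx) y (List.mem_reverse.1 hy)⟩

theorem pShape_eq {w : List ℕ} (hw : w.Nodup) : pShape w =
    ((leafTree w).map fun _ => (), (leafTree w.reverse).map fun _ => ()) := by
  rw [pShape, pSymbol_eq, rootTree_eq_leafTree_reverse w hw]

theorem IsPermWord.nodup {w : List ℕ} (h : IsPermWord w) : w.Nodup :=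
  h.nodup_iff.2 List.nodup_range'

theorem IsPermWord.mem_iff {w : List ℕ} (h : IsPermWord w) {x : ℕ} :
    x ∈ w ↔ 1 ≤ x ∧ x ≤ w.length := by
  rw [List.Perm.mem_iff h, List.mem_range'_1]
  omega

theorem isPermWord_of_perm {w : List ℕ} {n : ℕ} (h : w.Perm (List.range' 1 n)) : IsPermWord w := by
  have := h.length_eq
  rw [List.length_range'] at this
  rwa [IsPermWord, this]

/-- The `ℙ`-symbol is a complete invariant of the equivalence of permutations. -/
theorem pShape_eq_iff (σ τ : SPerm) : pShape σ.1 = pShape τ.1 ↔ Sim σ.1 τ.1 := by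
  have hσ := σ.2.nodup
  rw [pShape_eq hσ, pShape_eq τ.2.nodup, Prod.mk.injEq]
  have main : σ.1.Perm τ.1 → (((leafTree σ.1).map (fun _ => ()) =
      (leafTree τ.1).map (fun _ => ()) ∧ (leafTree σ.1.reverse).map (fun _ => ()) =
      (leafTree τ.1.reverse).map (fun _ => ())) ↔ Sim σ.1 τ.1) := by
    intro hp
    rw [map_leafTree_eq_iff hσ hp, map_leafTree_eq_iff (List.nodup_reverse.2 hσ)
      ((List.reverse_perm _).trans (hp.trans (List.reverse_perm _).symm))]
    simp only [first_reverse, List.mem_reverse]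
    exact ⟨fun h => ⟨hp, h.1, h.2⟩, fun h => ⟨h.first, h.last⟩⟩
  constructor
  · intro h
    refine (main ?_).1 h
    have := congrArg BinaryTree.numNodes h.1
    rw [numNodes_map, numNodes_map, numNodes_leafTree, numNodes_leafTree] at this
    exact List.Perm.trans σ.2 (by rw [this]; exact List.Perm.symm τ.2)
  · exact fun h => (main h.perm).2 h

/-! ### The canopies of the `ℙ`-symbol -/

theorem leafWord_leafTree {w : List ℕ} {s : ℕ} (hw : w.Perm (List.range' s w.length)) (o : Bool)
    (ho : o = false ∨ w ≠ []) : leafWord o ((leafTree w).map fun _ => ()) =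
      (List.range' s (w.length + 1)).map fun j => decide (j ∈ w ∧ ¬ Before w j (j - 1)) := by
  induction hn : w.length using Nat.strong_induction_on generalizing w s o with
  | _ n ih =>
    cases w with
    | nil =>
      obtain rfl : n = 0 := by simpa using hn.symm
      obtain rfl : o = false := by simpa using ho
      simp [leafTree, BinaryTree.map, leafWord]
    | cons a u =>
      have hnd : (a :: u).Nodup := hw.nodup_iff.2 List.nodup_range'
      have hmem : ∀ x, x ∈ a :: u ↔ s ≤ x ∧ x < s + n := by
        intro x
        rw [hw.mem_iff, List.mem_range'_1, hn]
      have ha := (hmem a).1 (by simp)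
      have hau := (List.nodup_cons.1 hnd).1
      have hmu : ∀ x, x ∈ u ↔ (s ≤ x ∧ x < s + n) ∧ x ≠ a := by
        intro x
        rw [← hmem, List.mem_cons]
        constructor
        · exact fun h => ⟨Or.inr h, by rintro rfl; exact hau h⟩
        · tauto
      have p1 : (u.filter (· < a)).Perm (List.range' s (a - s)) := by
        refine (List.perm_ext_iff_of_nodup (hnd.of_cons.filter _)
          List.nodup_range').2 fun x => ?_
        rw [List.mem_filter, hmu, List.mem_range'_1, decide_eq_true_eq]
        omega
      have p2 : (u.filter (a ≤ ·)).Perm (List.range' (a + 1) (s + n - (a + 1))) := by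
        refine (List.perm_ext_iff_of_nodup (hnd.of_cons.filter _)
          List.nodup_range').2 fun x => ?_
        rw [List.mem_filter, hmu, List.mem_range'_1, decide_eq_true_eq]
        omega
      have l1 : (u.filter (· < a)).length = a - s := by simpa using p1.length_eq
      have l2 : (u.filter (a ≤ ·)).length = s + n - (a + 1) := by simpa using p2.length_eq
      have i2 := ih _ (by omega) (by rw [l2]; exact p2) false (Or.inl rfl) l2
      have i1 : leafWord true ((leafTree (u.filter (· < a))).map fun _ => ()) =
          (List.range' s (a - s + 1)).map
            fun j => decide (j ∈ a :: u ∧ ¬ Before (a :: u) j (j - 1)) := by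
        by_cases hsa : s = a
        · have : u.filter (· < a) = [] := by
            rw [← List.length_eq_zero_iff]; omega
          rw [this, hsa]
          simp only [leafTree, List.foldl_nil, BinaryTree.map, leafWord, Nat.sub_self, zero_add,
            List.range'_one, List.map_cons, List.map_nil, List.cons.injEq, and_true]
          symm
          rw [decide_eq_true_eq]
          refine ⟨by simp, fun h => ?_⟩
          by_cases h0 : a = 0
          · exact h.ne hnd (by omega)
          · have := (hmem _).1 h.mem_right
            omega
        · have hne : u.filter (· < a) ≠ [] := by
            rw [← List.length_pos_iff]; omega
          rw [ih _ (by omega) (by rw [l1]; exact p1) true (Or.inr hne) l1]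
          refine List.map_congr_left fun j hj => ?_
          rw [List.mem_range'_1] at hj
          rw [decide_eq_decide, before_filter, List.mem_filter, before_cons, List.mem_cons,
            decide_eq_true_eq, decide_eq_true_eq]
          by_cases hja : j = a
          · subst hja
            have h1 : j - 1 ∈ u := (hmu _).2 (by omega)
            simp [h1]
          · have h1 : j < a := by omega
            have h2 : j - 1 < a := by omega
            simp [hja, h1, h2]
      rw [leafTree_cons, BinaryTree.map, leafWord, i1, i2]
      have e : n + 1 = (a - s + 1) + (s + n - (a + 1) + 1) := by omega
      rw [e, ← List.range'_append_1 (s := s) (m := a - s + 1), List.map_append]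
      have e2 : s + (a - s + 1) = a + 1 := by omega
      rw [e2]
      congr 1
      refine List.map_congr_left fun j hj => ?_
      rw [List.mem_range'_1] at hj
      rw [decide_eq_decide, before_filter, List.mem_filter, before_cons, List.mem_cons,
        decide_eq_true_eq, decide_eq_true_eq]
      have h1 : j ≠ a := by omega
      have h2 : a ≤ j := by omega
      have h3 : a ≤ j - 1 := by omega
      simp [h1, h2, h3]

/-- The leaf between the nodes `j - 1` and `j` is a left child of the leaf insertion tree exactly
when `j - 1` occurs before `j`. -/
theorem canopy_leafTree {w : List ℕ} (hw : IsPermWord w) :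
    canopy ((leafTree w).map fun _ => ()) =
      (List.range' 2 (w.length - 1)).map fun j => decide (Before w (j - 1) j) := by
  cases w with
  | nil => simp [leafTree, canopy, BinaryTree.map, leafWord]
  | cons a u =>
    rw [canopy, leafWord_leafTree hw true (by simp), ← List.map_tail, ← List.map_dropLast]
    rw [List.range'_succ, List.tail_cons, List.length_cons, List.range'_concat,
      List.dropLast_concat, Nat.add_sub_cancel]
    refine List.map_congr_left fun j hj => ?_
    rw [List.mem_range'_1] at hj
    rw [decide_eq_decide]
    have h1 : j ∈ a :: u := hw.mem_iff.2 (by simp; omega)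
    have h2 : j - 1 ∈ a :: u := hw.mem_iff.2 (by simp; omega)
    rw [not_before_iff hw.nodup h1 h2 (by omega)]
    simp only [h1, true_and]

theorem IsPermWord.reverse {w : List ℕ} (hw : IsPermWord w) : IsPermWord w.reverse :=
  isPermWord_of_perm ((List.reverse_perm w).trans hw)

theorem isTwin_pShape (σ : SPerm) : IsTwin (pShape σ.1) := by
  rw [pShape_eq σ.2.nodup]
  refine ⟨?_, ?_⟩
  · simp [numNodes_map, numNodes_leafTree]
  · rw [canopy_leafTree σ.2, canopy_leafTree σ.2.reverse, List.length_reverse, List.map_map]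
    refine List.map_congr_left fun j hj => ?_
    rw [List.mem_range'_1] at hj
    have h1 : j ∈ σ.1 := σ.2.mem_iff.2 (by omega)
    have h2 : j - 1 ∈ σ.1 := σ.2.mem_iff.2 (by omega)
    have hne : j - 1 ≠ j := by omega
    simp only [Function.comp, before_reverse, ← not_before_iff σ.2.nodup h2 h1 hne, decide_not]

/-- The pair of twin binary trees of a permutation. -/
def twins (σ : SPerm) : TBT := ⟨pShape σ.1, isTwin_pShape σ⟩

theorem twins_eq_iff {σ τ : SPerm} : twins σ = twins τ ↔ Sim σ.1 τ.1 := by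
  rw [← pShape_eq_iff, twins, twins, Subtype.mk.injEq]

theorem twins_size (σ : SPerm) : (twins σ).size = σ.1.length := by
  change (pShape σ.1).1.numNodes = _
  rw [pShape_eq σ.2.nodup, numNodes_map, numNodes_leafTree]

/-! ### Inversions and the permutohedron order -/

/-- Every inversion (by values) of `w` is an inversion of `w'`. -/
def InvLE (w w' : List ℕ) : Prop := ∀ a b, a < b → Before w b a → Before w' b a

theorem InvLE.refl (w : List ℕ) : InvLE w w := fun _ _ _ h => h

theorem InvLE.trans {w w' w'' : List ℕ} (h : InvLE w w') (h' : InvLE w' w'') : InvLE w w'' :=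
  fun a b hab hb => h' a b hab (h a b hab hb)

theorem InvLE.antisymm {w w' : List ℕ} (hw : w.Nodup) (hp : w.Perm w') (h : InvLE w w')
    (h' : InvLE w' w) : w = w' := by
  refine eq_of_before_imp hw hp fun x y hxy => ?_
  have hne := hxy.ne hw
  rcases lt_or_gt_of_ne hne with hlt | hlt
  · refine (not_before_iff (hp.nodup_iff.1 hw) (hp.mem_iff.1 hxy.mem_right)
      (hp.mem_iff.1 hxy.mem_left) (Ne.symm hne)).1 fun h1 => ?_
    exact (h' x y hlt h1).asymm hw hxy
  · exact h y x hlt hxy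

/-- The set of inversions `(a, b)`, with `b > a` occurring before `a`. -/
def invs (w : List ℕ) : Finset (ℕ × ℕ) :=
  (w.toFinset ×ˢ w.toFinset).filter fun q => q.1 < q.2 ∧ Before w q.2 q.1

theorem mem_invs {w : List ℕ} {q : ℕ × ℕ} : q ∈ invs w ↔ q.1 < q.2 ∧ Before w q.2 q.1 := by
  simp only [invs, Finset.mem_filter, Finset.mem_product, List.mem_toFinset, and_iff_right_iff_imp]
  exact fun h => ⟨h.2.mem_right, h.2.mem_left⟩

theorem invLE_iff {w w' : List ℕ} : InvLE w w' ↔ invs w ⊆ invs w' := by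
  constructor
  · intro h q hq
    rw [mem_invs] at hq ⊢
    exact ⟨hq.1, h _ _ hq.1 hq.2⟩
  · intro h a b hab hb
    exact (mem_invs.1 (h (mem_invs.2 (⟨hab, hb⟩ : (a, b).1 < (a, b).2 ∧ _)))).2

theorem Before.swap {X Y : List ℕ} {a b x y : ℕ} (h : Before (X ++ a :: b :: Y) x y) :
    (x = a ∧ y = b) ∨ Before (X ++ b :: a :: Y) x y := by
  simp only [before_append, before_cons, List.mem_cons] at h ⊢
  tauto

theorem perm_swap (X Y : List ℕ) (a b : ℕ) : (X ++ a :: b :: Y).Perm (X ++ b :: a :: Y) :=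
  (List.Perm.swap b a Y).append_left X

theorem before_adjacent (X Y : List ℕ) (a b : ℕ) : Before (X ++ a :: b :: Y) a b := by
  simp [before_append, before_cons]

theorem invLE_swap {X Y : List ℕ} {a b : ℕ} (hab : a < b) :
    InvLE (X ++ a :: b :: Y) (X ++ b :: a :: Y) := by
  intro c d hcd h
  rcases h.swap with ⟨rfl, rfl⟩ | h
  · omega
  · exact h

theorem card_invs_swap_lt {X Y : List ℕ} {a b : ℕ} (hw : (X ++ a :: b :: Y).Nodup) (hab : a < b) :
    (invs (X ++ a :: b :: Y)).card < (invs (X ++ b :: a :: Y)).card := by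
  refine Finset.card_lt_card ⟨invLE_iff.1 (invLE_swap hab), fun h => ?_⟩
  have : (a, b) ∈ invs (X ++ a :: b :: Y) := h (mem_invs.2 ⟨hab, before_adjacent X Y b a⟩)
  exact (mem_invs.1 this).2.asymm hw (before_adjacent X Y a b)

theorem permLE_of_invLE {σ ν : SPerm} (hp : σ.1.Perm ν.1) (h : InvLE σ.1 ν.1) : σ.PermLE ν := by
  induction hn : (invs ν.1).card using Nat.strong_induction_on generalizing ν with
  | _ n ih =>
    by_cases hne : σ.1 = ν.1
    · rw [Subtype.ext hne]
      exact Relation.ReflTransGen.refl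
    obtain ⟨X, Y, b, a, e, hab⟩ := exists_adjacent_of_ne σ.2.nodup hp hne
    have hlt : a < b := by
      refine lt_of_le_of_ne (not_lt.1 fun hba => ?_) (hab.ne σ.2.nodup)
      refine (h b a hba hab).asymm ν.2.nodup ?_
      rw [e]
      exact before_adjacent X Y b a
    have hp' : ν.1.Perm (X ++ a :: b :: Y) := by rw [e]; exact perm_swap X Y b a
    have hnd := hp'.nodup_iff.1 ν.2.nodup
    let ν' : SPerm := ⟨X ++ a :: b :: Y, isPermWord_of_perm (hp'.symm.trans ν.2)⟩
    have hle : InvLE σ.1 ν'.1 := by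
      intro c d hcd hdc
      have h1 := h c d hcd hdc
      rw [e] at h1
      rcases h1.swap with ⟨rfl, rfl⟩ | h1
      · exact absurd hdc (hab.asymm σ.2.nodup)
      · exact h1
    have hcard := card_invs_swap_lt hnd hlt
    rw [← e, hn] at hcard
    refine (ih _ hcard (ν := ν') (hp.trans hp') hle rfl).tail ?_
    exact ⟨X, Y, a, b, hlt, by simp [ν'], by simp [e]⟩

/-- The permutohedron order is the inclusion order of the sets of inversions. -/
theorem permLE_iff {σ ν : SPerm} : σ.PermLE ν ↔ σ.1.Perm ν.1 ∧ InvLE σ.1 ν.1 := by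
  refine ⟨fun h => ?_, fun h => permLE_of_invLE h.1 h.2⟩
  induction h with
  | refl => exact ⟨List.Perm.refl _, InvLE.refl _⟩
  | @tail ρ τ _ hc ih =>
    obtain ⟨u, v, a, b, hab, e1, e2⟩ := hc
    simp only [List.append_assoc, List.cons_append, List.nil_append] at e1 e2
    rw [e2]
    rw [e1] at ih
    exact ⟨ih.1.trans (perm_swap u v a b), ih.2.trans (invLE_swap hab)⟩

/-! ### The smallest permutation of an equivalence class -/

/-- No two adjacent decreasing letters `d a` of `w` have a letter of intermediate value before them
and another one after them. -/
def Bottom (w : List ℕ) : Prop :=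
  ∀ (X Y : List ℕ) (d a : ℕ), w = X ++ d :: a :: Y → a < d →
    (∀ p ∈ X, ¬ (a < p ∧ p < d)) ∨ (∀ s ∈ Y, ¬ (a < s ∧ s < d))

theorem First.swap {X Y : List ℕ} {b c p x y : ℕ} (hw : (X ++ b :: c :: Y).Nodup) (hp : p ∈ X)
    (h1 : min b c ≤ p) (h2 : p ≤ max b c) (h : First (X ++ b :: c :: Y) x y) :
    First (X ++ c :: b :: Y) x y := by
  intro z hz hzx hz1 hz2
  have h3 := h z ((perm_swap X Y b c).mem_iff.2 hz) hzx hz1 hz2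
  rcases h3.swap with ⟨rfl, rfl⟩ | h4
  · exfalso
    have hpb : Before (X ++ x :: z :: Y) p x := (before_middle' hw rfl).2 hp
    exact hpb.asymm hw (h p (by simp [hp]) (hpb.ne hw) (by omega) (by omega))
  · exact h4

theorem Last.swap {X Y : List ℕ} {b c s x y : ℕ} (hw : (X ++ b :: c :: Y).Nodup) (hs : s ∈ Y)
    (h1 : min b c ≤ s) (h2 : s ≤ max b c) (h : Last (X ++ b :: c :: Y) x y) :
    Last (X ++ c :: b :: Y) x y := by
  rw [← first_reverse] at h ⊢
  have e : ∀ b c, (X ++ b :: c :: Y).reverse = Y.reverse ++ c :: b :: X.reverse := by simp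
  have hw' := List.nodup_reverse.2 hw
  rw [e] at h hw' ⊢
  exact h.swap hw' (List.mem_reverse.2 hs) (by omega) (by omega)

/-- The elementary move: two adjacent letters may be exchanged when a letter of intermediate value
comes before them and another one after them. -/
theorem sim_swap {X Y : List ℕ} {b c p s : ℕ} (hw : (X ++ b :: c :: Y).Nodup) (hp : p ∈ X)
    (hp1 : min b c ≤ p) (hp2 : p ≤ max b c) (hs : s ∈ Y) (hs1 : min b c ≤ s)
    (hs2 : s ≤ max b c) : Sim (X ++ b :: c :: Y) (X ++ c :: b :: Y) := by
  have hw' := (perm_swap X Y b c).nodup_iff.1 hw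
  exact ⟨perm_swap X Y b c,
    fun x _ y _ => ⟨First.swap hw hp hp1 hp2, First.swap hw' hp (by omega) (by omega)⟩,
    fun x _ y _ => ⟨Last.swap hw hs hs1 hs2, Last.swap hw' hs (by omega) (by omega)⟩⟩

theorem exists_bottom {w : List ℕ} (hw : w.Nodup) : ∃ μ, Bottom μ ∧ Sim w μ := by
  induction hn : (invs w).card using Nat.strong_induction_on generalizing w with
  | _ n ih =>
    by_cases hb : Bottom w
    · exact ⟨w, hb, Sim.refl w⟩
    simp only [Bottom] at hb
    push Not at hb
    obtain ⟨X, Y, d, a, rfl, had, ⟨p, hp, hp1, hp2⟩, ⟨s, hs, hs1, hs2⟩⟩ := hb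
    have hw' := (perm_swap X Y d a).nodup_iff.1 hw
    have hc := card_invs_swap_lt hw' had
    obtain ⟨μ, hμ, hsim⟩ := ih _ (hn ▸ hc) hw' rfl
    exact ⟨μ, hμ, (sim_swap hw hp (by omega) (by omega) hs (by omega) (by omega)).trans hsim⟩

theorem exists_last_of_exists {p : ℕ → Prop} {l : List ℕ} (h : ∃ x ∈ l, p x) :
    ∃ U z V, l = U ++ z :: V ∧ p z ∧ ∀ y ∈ V, ¬ p y := by
  induction l with
  | nil => simp at h
  | cons a u ih =>
    by_cases hu : ∃ x ∈ u, p x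
    · obtain ⟨U, z, V, rfl, hz, hV⟩ := ih hu
      exact ⟨a :: U, z, V, rfl, hz, hV⟩
    · push Not at hu
      obtain ⟨x, hx, hpx⟩ := h
      rw [List.mem_cons] at hx
      rcases hx with rfl | hx
      · exact ⟨[], x, u, rfl, hpx, hu⟩
      · exact absurd hpx (hu x hx)

/-- Suppose that `d` occurs before a smaller `a` in a word with the property `Bottom`, with no
letter of intermediate value in between. Then either `d` comes first among the values from `a` to
`d`, or `a` comes last among them. -/
theorem Bottom.first_or_last {X M Y : List ℕ} {a d : ℕ} (hnd : (X ++ d :: (M ++ a :: Y)).Nodup)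
    (hb : Bottom (X ++ d :: (M ++ a :: Y))) (had : a < d) (hM : ∀ e ∈ M, e < a ∨ d < e) :
    First (X ++ d :: (M ++ a :: Y)) d a ∨ Last (X ++ d :: (M ++ a :: Y)) a d := by
  -- the last letter `p ≥ d` between `d` and `a` is followed by a letter `q ≤ a`
  obtain ⟨U, p, V, e, hp, hV⟩ := exists_last_of_exists (p := fun x => d ≤ x) (l := d :: M)
    ⟨d, by simp, le_rfl⟩
  have hU : U = [] ∨ d ∈ U := by
    cases U with
    | nil => exact Or.inl rfl
    | cons c U =>
      simp only [List.cons_append, List.cons.injEq] at e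
      exact Or.inr (by simp [e.1])
  have hVa : ∀ y ∈ V, y < a := by
    intro y hy
    have h1 := hV y hy
    have h2 : y ∈ d :: M := by rw [e]; simp [hy]
    rw [List.mem_cons] at h2
    rcases h2 with rfl | h2
    · omega
    · have := hM y h2
      omega
  obtain ⟨q, R, hqR, hq, hR⟩ : ∃ q R, V ++ a :: Y = q :: (R ++ Y) ∧ q ≤ a ∧ (V = [] ∧ q = a ∨
      a ∈ R) := by
    cases V with
    | nil => exact ⟨a, [], rfl, le_rfl, Or.inl ⟨rfl, rfl⟩⟩
    | cons q V => exact ⟨q, V ++ [a], by simp, (hVa q (by simp)).le, Or.inr (by simp)⟩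
  have ew : X ++ d :: (M ++ a :: Y) = (X ++ U) ++ p :: q :: (R ++ Y) := by
    rw [← hqR, ← List.cons_append, e]
    simp
  rcases hb _ _ p q ew (by omega) with h | h
  · left
    rcases hU with rfl | hU
    · simp only [List.nil_append, List.cons.injEq] at e
      obtain ⟨rfl, rfl⟩ := e
      intro z hz hzd h1 h2
      rw [before_middle hnd rfl]
      rw [List.mem_append, List.mem_cons] at hz
      refine (hz.resolve_left fun hzX => ?_).resolve_left hzd
      refine h z (by simpa using hzX) ⟨lt_of_le_of_ne (by omega) ?_, by omega⟩
      intro hqz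
      have ha : z ∈ M ++ a :: Y := by
        have : z = a := by omega
        simp [this]
      exact (List.disjoint_of_nodup_append hnd) hzX (List.mem_cons_of_mem _ ha)
    · refine absurd ⟨by omega, lt_of_le_of_ne hp ?_⟩ (h d (by simp [hU]))
      rintro rfl
      rw [ew] at hnd
      exact (List.disjoint_of_nodup_append hnd) (List.mem_append_right X hU) (by simp)
  · right
    rcases hR with ⟨rfl, rfl⟩ | hR
    · have e2 : X ++ d :: (M ++ q :: Y) = (X ++ d :: M) ++ q :: Y := by simp
      intro z hz hzq h1 h2
      rw [before_middle' hnd e2]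
      rw [e2, List.mem_append, List.mem_cons] at hz
      refine hz.resolve_right fun hz' => ?_
      have hzY := hz'.resolve_left hzq
      refine h z (by simp [hzY]) ⟨by omega, lt_of_le_of_ne (by omega) ?_⟩
      rintro rfl
      obtain rfl : z = d := by omega
      rw [e2] at hnd
      exact (List.disjoint_of_nodup_append hnd) (by simp) (List.mem_cons_of_mem _ hzY)
    · refine absurd ⟨lt_of_le_of_ne hq ?_, by omega⟩ (h a (by simp [hR]))
      rintro rfl
      rw [ew, List.nodup_append, List.nodup_cons, List.nodup_cons] at hnd
      exact hnd.2.1.2.1 (by simp [hR])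

/-- The inversions of a word with the property `Bottom` are generated, under transitivity, by those
that come from a letter which is first or last in an interval of values. -/
theorem Bottom.invLE {μ ν : List ℕ} (hμ : μ.Nodup) (hν : ν.Nodup) (hb : Bottom μ)
    (h : ∀ a d, a < d → Before μ d a → First μ d a ∨ Last μ a d → Before ν d a) :
    InvLE μ ν := by
  have main : ∀ (n : ℕ) (X M Y : List ℕ) (a d : ℕ), M.length = n →
      μ = X ++ d :: (M ++ a :: Y) → a < d → Before ν d a := by
    intro n
    induction n using Nat.strong_induction_on with
    | _ n ih =>
      intro X M Y a d hn e had
      by_cases hM : ∃ c ∈ M, a < c ∧ c < d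
      · obtain ⟨c, hc, hac, hcd⟩ := hM
        obtain ⟨M₁, M₂, rfl⟩ := List.append_of_mem hc
        simp only [List.length_append, List.length_cons] at hn
        exact (ih M₁.length (by omega) X M₁ (M₂ ++ a :: Y) c d rfl (by simp [e]) hcd).trans hν
          (ih M₂.length (by omega) (X ++ d :: M₁) M₂ Y a c rfl (by simp [e]) hac)
      · push Not at hM
        have hda : Before μ d a := (before_middle hμ e).2 (by simp)
        refine h a d had hda ?_
        subst e
        refine Bottom.first_or_last hμ hb had fun c hc => ?_
        have h1 := hM c hc
        have hne1 : c ≠ a := by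
          rintro rfl
          rw [List.nodup_append, List.nodup_cons, List.nodup_append] at hμ
          exact hμ.2.1.2.2.2 c hc c (by simp) rfl
        have hne2 : c ≠ d := by
          rintro rfl
          rw [List.nodup_append, List.nodup_cons] at hμ
          exact hμ.2.1.1 (by simp [hc])
        omega
  intro a d had hda
  obtain ⟨X, Z, rfl⟩ := List.append_of_mem hda.mem_left
  obtain ⟨M, Y, rfl⟩ := List.append_of_mem ((before_middle hμ rfl).1 hda)
  exact main _ X M Y a d rfl rfl had

/-- The words with the property `Bottom` are the minima of the equivalence classes, and taking the
minimum of the class is order preserving. -/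
theorem Bottom.invLE_of_sim {μ σ₀ σ₁ ν : List ℕ} (hμ : μ.Nodup) (hb : Bottom μ)
    (h₀ : Sim μ σ₀) (hp : σ₀.Perm σ₁) (hle : InvLE σ₀ σ₁) (h₁ : Sim σ₁ ν) : InvLE μ ν := by
  have hn₁ := (h₀.perm.trans hp).nodup_iff.1 hμ
  refine hb.invLE hμ (h₁.perm.nodup_iff.1 hn₁) fun a d had hda h => ?_
  have hm₀ : ∀ x, x ∈ μ → x ∈ σ₀ := fun x => h₀.perm.mem_iff.1
  have hm₁ : ∀ x, x ∈ μ → x ∈ σ₁ := fun x => (h₀.perm.trans hp).mem_iff.1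
  have hm : ∀ x, x ∈ μ → x ∈ ν := fun x => ((h₀.perm.trans hp).trans h₁.perm).mem_iff.1
  have ha := hda.mem_right
  have hd := hda.mem_left
  rcases h with h | h
  · rw [h₀.first d hd a ha] at h
    have h' : First σ₁ d a := fun z hz hzd h1 h2 =>
      hle z d (by omega) (h z (hp.mem_iff.2 hz) hzd h1 h2)
    rw [h₁.first d (hm₁ d hd) a (hm₁ a ha)] at h'
    exact h' a (hm a ha) (by omega) (by omega) (by omega)
  · rw [h₀.last a ha d hd] at h
    have h' : Last σ₁ a d := fun z hz hza h1 h2 =>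
      hle a z (by omega) (h z (hp.mem_iff.2 hz) hza h1 h2)
    rw [h₁.last a (hm₁ a ha) d (hm₁ d hd)] at h'
    exact h' d (hm d hd) (by omega) (by omega) (by omega)

theorem Bottom.invLE_sim {μ ν : List ℕ} (hμ : μ.Nodup) (hb : Bottom μ) (h : Sim μ ν) :
    InvLE μ ν :=
  hb.invLE_of_sim hμ (Sim.refl μ) (List.Perm.refl μ) (InvLE.refl μ) h

theorem Bottom.eq_of_sim {μ ν : List ℕ} (hμ : μ.Nodup) (hb : Bottom μ) (hb' : Bottom ν)
    (h : Sim μ ν) : μ = ν :=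
  InvLE.antisymm hμ h.perm (hb.invLE_sim hμ h) (hb'.invLE_sim (h.perm.nodup_iff.1 hμ) h.symm)

theorem exists_bottom_sperm (σ : SPerm) : ∃ μ : SPerm, Bottom μ.1 ∧ Sim σ.1 μ.1 := by
  obtain ⟨μ, hb, hs⟩ := exists_bottom σ.2.nodup
  exact ⟨⟨μ, isPermWord_of_perm (hs.perm.symm.trans σ.2)⟩, hb, hs⟩

/-! ### Baxter permutations -/

/-- The words that avoid the two Baxter patterns: when `q r` are adjacent, `p` comes before them
and `s` after them, `p q r s` has neither the standardization `2413` nor `3142`. -/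
def WordBaxter (w : List ℕ) : Prop :=
  ∀ (X Y : List ℕ) (q r : ℕ), w = X ++ q :: r :: Y → ∀ p ∈ X, ∀ s ∈ Y,
    ¬ (r < p ∧ p < s ∧ s < q) ∧ ¬ (q < s ∧ s < p ∧ p < r)

theorem isBaxter_iff {σ : SPerm} : σ.IsBaxter ↔ WordBaxter σ.1 := by
  constructor
  · intro h X Y q r e p hp s hs
    obtain ⟨x, u, rfl⟩ := List.append_of_mem hp
    obtain ⟨v, y, rfl⟩ := List.append_of_mem hs
    exact h x u v y p q r s (by simp [e])
  · intro h x u v y p q r s e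
    exact h (x ++ p :: u) (v ++ s :: y) q r (by simp [e]) p (by simp) s (by simp)

theorem WordBaxter.reverse {w : List ℕ} (h : WordBaxter w) : WordBaxter w.reverse := by
  intro X Y q r e p hp s hs
  have e' : w = Y.reverse ++ r :: q :: X.reverse := by
    rw [← List.reverse_reverse w, e]
    simp
  have := h _ _ _ _ e' s (by simpa using hs) p (by simpa using hp)
  omega

theorem first_filter {w : List ℕ} {P : ℕ → Bool} {x y : ℕ}
    (h : ∀ z, min x y ≤ z → z ≤ max x y → P z = true) :
    First (w.filter P) x y ↔ First w x y := by
  have hx := h x (by omega) (by omega)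
  simp only [First, before_filter, List.mem_filter]
  constructor
  · exact fun h' z hz hzx h1 h2 => (h' z ⟨hz, h z h1 h2⟩ hzx h1 h2).1
  · exact fun h' z hz hzx h1 h2 => ⟨h' z hz.1 hzx h1 h2, hx, hz.2⟩

theorem last_filter {w : List ℕ} {P : ℕ → Bool} {x y : ℕ}
    (h : ∀ z, min x y ≤ z → z ≤ max x y → P z = true) :
    Last (w.filter P) x y ↔ Last w x y := by
  rw [← first_reverse, ← first_reverse, ← List.filter_reverse, first_filter h]

/-- The largest letter `n + 1` of the word `w` comes after the letters `q + 1, …, n` and before the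
letter `q < n` (if `q` is not `0`). -/
structure MaxInserted (w : List ℕ) (n q : ℕ) : Prop where
  perm : w.Perm (List.range' 1 (n + 1))
  lt : q < n
  after : ∀ z, q < z → z ≤ n → Before w z (n + 1)
  before : 1 ≤ q → Before w (n + 1) q

namespace MaxInserted

variable {w : List ℕ} {n q x y : ℕ}

theorem nodup (h : MaxInserted w n q) : w.Nodup := h.perm.nodup_iff.2 List.nodup_range'

theorem mem_iff (h : MaxInserted w n q) {z : ℕ} : z ∈ w ↔ 1 ≤ z ∧ z ≤ n + 1 := by
  rw [h.perm.mem_iff, List.mem_range'_1]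
  omega

theorem not_first (h : MaxInserted w n q) (hy : y ≤ n) : ¬ First w (n + 1) y := by
  intro hf
  have hn := h.after n h.lt le_rfl
  exact hn.asymm h.nodup (hf n hn.mem_left (by omega) (by omega) (by omega))

theorem first_max (h : MaxInserted w n q) (hx : x ≤ n) :
    First w x (n + 1) ↔ First (w.filter (· ≤ n)) x n := by
  rw [first_filter (fun z _ h2 => by simp; omega)]
  have hn := h.after n h.lt le_rfl
  constructor
  · exact fun hf z hz hzx h1 h2 => hf z hz hzx (by omega) (by omega)
  · intro hf z hz hzx h1 h2
    by_cases hzn : z = n + 1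
    · subst hzn
      by_cases hxn : x = n
      · exact hxn ▸ hn
      · exact (hf n hn.mem_left (Ne.symm hxn) (by omega) (by omega)).trans h.nodup hn
    · exact hf z hz hzx (by omega) (by omega)

theorem last_max_left (h : MaxInserted w n q) (hy1 : 1 ≤ y) (hy : y ≤ n) :
    Last w (n + 1) y ↔ q < y := by
  constructor
  · intro hl
    by_contra hqy
    have hq := h.before (by omega)
    exact hq.asymm h.nodup (hl q hq.mem_right (by have := h.lt; omega) (by omega)
      (by have := h.lt; omega))
  · exact fun hqy z hz hzn h1 h2 => h.after z (by omega) (by omega)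

theorem last_max_right (h : MaxInserted w n q) (hx1 : 1 ≤ x) (hx : x ≤ n) :
    Last w x (n + 1) ↔ x ≤ q ∧ Last (w.filter (· ≤ n)) x n := by
  rw [last_filter (fun z _ h2 => by simp; omega)]
  have hlt := h.lt
  constructor
  · intro hl
    refine ⟨?_, fun z hz hzx h1 h2 => hl z hz hzx (by omega) (by omega)⟩
    by_contra hxq
    exact (h.after x (by omega) hx).asymm h.nodup
      (hl (n + 1) (h.mem_iff.2 (by omega)) (by omega) (by omega) (by omega))
  · rintro ⟨hxq, hl⟩ z hz hzx h1 h2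
    have hq := h.before (by omega)
    by_cases hzn : z = n + 1
    · subst hzn
      by_cases hx' : x = q
      · exact hx' ▸ hq
      · exact hq.trans h.nodup (hl q hq.mem_right (Ne.symm hx') (by omega) (by omega))
    · exact hl z hz hzx (by omega) (by omega)

/-- The equivalence class of `w` only depends on `q` and on the equivalence class of the word
obtained by deleting the largest letter. -/
theorem sim {w' : List ℕ} (h : MaxInserted w n q) (h' : MaxInserted w' n q)
    (hs : Sim (w.filter (· ≤ n)) (w'.filter (· ≤ n))) : Sim w w' := by
  have hf : ∀ z, 1 ≤ z → z ≤ n → z ∈ w.filter (· ≤ n) := by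
    intro z h1 h2
    rw [List.mem_filter, h.mem_iff]
    simp; omega
  refine ⟨h.perm.trans h'.perm.symm, fun x hx y hy => ?_, fun x hx y hy => ?_⟩ <;>
    rw [h.mem_iff] at hx hy <;>
    rcases Nat.lt_or_eq_of_le hx.2 with hxn | rfl <;>
    rcases Nat.lt_or_eq_of_le hy.2 with hyn | rfl
  · have e : ∀ z, min x y ≤ z → z ≤ max x y → decide (z ≤ n) = true := fun z _ _ => by
      simp; omega
    rw [← first_filter (w := w) e, ← first_filter (w := w') e]
    exact hs.first x (hf x (by omega) (by omega)) y (hf y (by omega) (by omega))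
  · rw [h.first_max (by omega), h'.first_max (by omega)]
    exact hs.first x (hf x (by omega) (by omega)) n (hf n (by omega) (by omega))
  · simp [h.not_first (y := y) (by omega), h'.not_first (y := y) (by omega)]
  · exact iff_of_true (fun z _ hz h1 h2 => absurd (by omega) hz)
      (fun z _ hz h1 h2 => absurd (by omega) hz)
  · have e : ∀ z, min x y ≤ z → z ≤ max x y → decide (z ≤ n) = true := fun z _ _ => by
      simp; omega
    rw [← last_filter (w := w) e, ← last_filter (w := w') e]
    exact hs.last x (hf x (by omega) (by omega)) y (hf y (by omega) (by omega))
  · rw [h.last_max_right hx.1 (by omega), h'.last_max_right hx.1 (by omega)]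
    exact and_congr_right fun _ =>
      hs.last x (hf x (by omega) (by omega)) n (hf n (by omega) (by omega))
  · rw [h.last_max_left hy.1 (by omega), h'.last_max_left hy.1 (by omega)]
  · exact iff_of_true (fun z _ hz h1 h2 => absurd (by omega) hz)
      (fun z _ hz h1 h2 => absurd (by omega) hz)

end MaxInserted

theorem exists_max (C : List ℕ) : ∃ q, (∀ c ∈ C, c ≤ q) ∧ (q = 0 ∨ q ∈ C) := by
  induction C with
  | nil => exact ⟨0, by simp, Or.inl rfl⟩
  | cons a C ih =>
    obtain ⟨q, h1, h2⟩ := ih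
    rcases le_total a q with h | h
    · exact ⟨q, by simpa using ⟨h, h1⟩, h2.imp id (fun h => by simp [h])⟩
    · exact ⟨a, by simpa using fun c hc => (h1 c hc).trans h, Or.inr (by simp)⟩

theorem filter_insert_max {U V : List ℕ} {n : ℕ} (h : ∀ x ∈ U ++ V, x ≤ n) :
    (U ++ (n + 1) :: V).filter (· ≤ n) = U ++ V := by
  rw [List.filter_append, List.filter_cons_of_neg (by simp), ← List.filter_append,
    List.filter_eq_self]
  simpa using h

theorem perm_insert_max {w : List ℕ} {n : ℕ} (h : w.Perm (List.range' 1 n)) :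
    ((n + 1) :: w).Perm (List.range' 1 (n + 1)) := by
  rw [List.range'_concat, one_mul, add_comm 1 n]
  exact (h.cons _).trans (List.perm_append_singleton _ _).symm

theorem perm_filter_max {w : List ℕ} {n : ℕ} (h : w.Perm (List.range' 1 (n + 1))) :
    (w.filter (· ≤ n)).Perm (List.range' 1 n) := by
  refine (List.perm_ext_iff_of_nodup ((h.nodup_iff.2 List.nodup_range').filter _)
    List.nodup_range').2 fun x => ?_
  rw [List.mem_filter, h.mem_iff, List.mem_range'_1, List.mem_range'_1, decide_eq_true_eq]
  omega

theorem eq_of_append_cons_eq {X Y X' Y' : List ℕ} {a : ℕ} (hnd : (X ++ a :: Y).Nodup)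
    (e : X ++ a :: Y = X' ++ a :: Y') : X = X' ∧ Y = Y' := by
  rw [List.nodup_middle, List.nodup_cons, List.mem_append, not_or] at hnd
  have := (List.append_cons_inj_of_notMem hnd.1.1 hnd.1.2).1 e
  exact ⟨this.1, this.2.2⟩

/-- Inserting a new largest letter right after the last letter `z > q` of a Baxter word yields a
Baxter word. -/
theorem WordBaxter.insert_max {U V : List ℕ} {z n q : ℕ} (hb : WordBaxter (U ++ z :: V))
    (hnd : (U ++ z :: V).Nodup) (hle : ∀ x ∈ U ++ z :: V, x ≤ n) (hz : q < z)
    (hV : ∀ y ∈ V, y ≤ q) (hq : 1 ≤ q → q ∈ V) : WordBaxter (U ++ z :: (n + 1) :: V) := by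
  have hfil : (U ++ z :: (n + 1) :: V).filter (· ≤ n) = U ++ z :: V := by
    have := filter_insert_max (U := U ++ [z]) (V := V) (n := n) (by simpa using hle)
    simpa using this
  have hnd' : (U ++ z :: (n + 1) :: V).Nodup := by
    have e : U ++ z :: (n + 1) :: V = (U ++ [z]) ++ (n + 1) :: V := by simp
    rw [e, List.nodup_middle, List.nodup_cons]
    refine ⟨fun h => ?_, by simpa using hnd⟩
    have := hle (n + 1) (by simpa using h)
    omega
  have hle' : ∀ x ∈ U ++ z :: (n + 1) :: V, x ≤ n + 1 := by
    intro x hx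
    by_cases hxn : x = n + 1
    · exact hxn.le
    · have : x ∈ U ++ z :: V := by
        simp only [List.mem_append, List.mem_cons, hxn, false_or] at hx ⊢
        exact hx
      have := hle x this
      omega
  intro X Y Q R e p hp s hs
  have hmem : ∀ x, x ∈ X ++ Q :: R :: Y → x ≤ n + 1 := fun x hx => hle' x (e ▸ hx)
  have hpn := hmem p (by simp [hp])
  have hsn := hmem s (by simp [hs])
  have hQn := hmem Q (by simp)
  have hRn := hmem R (by simp)
  by_cases hR : R = n + 1
  · -- the new letter is the second of the two adjacent ones: the first one is `z`
    subst hR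
    refine ⟨by omega, ?_⟩
    have e1 : (X ++ [Q]) ++ (n + 1) :: Y = (U ++ [z]) ++ (n + 1) :: V := by simp [← e]
    have hnd1 : ((X ++ [Q]) ++ (n + 1) :: Y).Nodup := by rw [e1]; simpa using hnd'
    obtain ⟨e2, rfl⟩ := eq_of_append_cons_eq hnd1 e1
    have hQz : Q = z := List.singleton_injective (List.append_inj' e2 rfl).2
    have := hV s hs
    omega
  by_cases hQ : Q = n + 1
  · -- the new letter is the first of the two: `z R` are adjacent in the given word
    subst hQ
    refine ⟨?_, by omega⟩
    rintro ⟨h1, h2, h3⟩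
    have e1 : X ++ (n + 1) :: (R :: Y) = (U ++ [z]) ++ (n + 1) :: V := by simp [← e]
    have hnd1 : (X ++ (n + 1) :: (R :: Y)).Nodup := by rw [← e]; exact hnd'
    obtain ⟨rfl, rfl⟩ := eq_of_append_cons_eq hnd1 e1
    have hsq := hV s (by simp [hs])
    have hqV := hq (by omega)
    have hqY : q ∈ Y := by
      rw [List.mem_cons] at hqV
      exact hqV.resolve_left (by omega)
    have hpU : p ∈ U := by
      rw [List.mem_append, List.mem_singleton] at hp
      exact hp.resolve_right (by omega)
    exact (hb U Y z R rfl p hpU q hqY).1 ⟨h1, by omega, hz⟩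
  · by_cases hp' : p = n + 1
    · omega
    by_cases hs' : s = n + 1
    · omega
    have e1 : U ++ z :: V = X.filter (· ≤ n) ++ Q :: R :: Y.filter (· ≤ n) := by
      rw [← hfil, e, List.filter_append, List.filter_cons_of_pos (by simp; omega),
        List.filter_cons_of_pos (by simp; omega)]
    exact hb _ _ Q R e1 p (List.mem_filter.2 ⟨hp, by simp; omega⟩) s
      (List.mem_filter.2 ⟨hs, by simp; omega⟩)

/-- Every equivalence class contains a Baxter permutation. The largest letter is inserted as close
as possible to the second largest one. -/
theorem exists_wordBaxter (n : ℕ) (w : List ℕ) (hw : w.Perm (List.range' 1 n)) :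
    ∃ τ, WordBaxter τ ∧ Sim w τ := by
  induction n generalizing w with
  | zero =>
    obtain rfl : w = [] := by simpa using hw
    exact ⟨[], fun X Y q r e => by simp at e, Sim.refl _⟩
  | succ n ih =>
    rcases Nat.eq_zero_or_pos n with rfl | hn
    · refine ⟨w, fun X Y q r e => ?_, Sim.refl _⟩
      have := hw.length_eq
      rw [e] at this
      simp at this
      omega
    have core : ∀ w : List ℕ, w.Perm (List.range' 1 (n + 1)) → Before w n (n + 1) →
        ∃ τ, WordBaxter τ ∧ Sim w τ := by
      intro w hw hbef
      have hnd : w.Nodup := hw.nodup_iff.2 List.nodup_range'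
      have hmem : ∀ x, x ∈ w ↔ 1 ≤ x ∧ x ≤ n + 1 := by
        intro x
        rw [hw.mem_iff, List.mem_range'_1]
        omega
      obtain ⟨A, C, e⟩ := List.append_of_mem hbef.mem_right
      obtain ⟨q, hq1, hq2⟩ := exists_max C
      have hC : ∀ c, Before w (n + 1) c ↔ c ∈ C := fun c => before_middle hnd e
      have hA : ∀ c, Before w c (n + 1) ↔ c ∈ A := fun c => before_middle' hnd e
      have hqn : q < n := by
        rcases hq2 with h | h
        · omega
        · have h1 := (hC q).2 h
          have h2 := (hmem q).1 h1.mem_right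
          have h3 := h1.ne hnd
          refine lt_of_le_of_ne (by omega) ?_
          rintro rfl
          exact h1.asymm hnd hbef
      have hI : MaxInserted w n q := by
        refine ⟨hw, hqn, fun z h1 h2 => ?_, fun h => ?_⟩
        · refine (not_before_iff hnd hbef.mem_right ((hmem z).2 (by omega)) (by omega)).1 ?_
          intro h
          have := hq1 z ((hC z).1 h)
          omega
        · exact (hC q).2 (hq2.resolve_left (by omega))
      have hu := perm_filter_max hw
      obtain ⟨τ, hτ, hs⟩ := ih _ hu
      have hpτ : τ.Perm (List.range' 1 n) := hs.perm.symm.trans hu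
      have hndτ : τ.Nodup := hpτ.nodup_iff.2 List.nodup_range'
      have hmemτ : ∀ x, x ∈ τ ↔ 1 ≤ x ∧ x ≤ n := by
        intro x
        rw [hpτ.mem_iff, List.mem_range'_1]
        omega
      obtain ⟨U, z, V, rfl, hz, hV⟩ := exists_last_of_exists (p := fun x => q < x) (l := τ)
        ⟨n, (hmemτ n).2 (by omega), hqn⟩
      have hqV : 1 ≤ q → q ∈ V := by
        intro h1
        have hqw : q ∈ w.filter (· ≤ n) := by
          rw [List.mem_filter, hmem]; simp; omega
        have hnw : n ∈ w.filter (· ≤ n) := by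
          rw [List.mem_filter, hmem]; simp; omega
        have hl : Last (w.filter (· ≤ n)) q n := by
          intro y hy hyq h2 h3
          rw [before_filter]
          exact ⟨(hI.after y (by omega) (by omega)).trans hnd (hI.before h1), by simp; omega,
            by simp; omega⟩
        rw [hs.last q hqw n hnw] at hl
        have hzn := (hmemτ z).1 (by simp)
        exact (before_middle hndτ rfl).1 (hl z (by simp) (by omega) (by omega) (by omega))
      have hle : ∀ x ∈ U ++ z :: V, x ≤ n := fun x hx => ((hmemτ x).1 hx).2
      have hfil : (U ++ z :: (n + 1) :: V).filter (· ≤ n) = U ++ z :: V := by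
        have := filter_insert_max (U := U ++ [z]) (V := V) (n := n) (by simpa using hle)
        simpa using this
      have eN : U ++ z :: (n + 1) :: V = (U ++ [z]) ++ (n + 1) :: V := by simp
      have hI' : MaxInserted (U ++ z :: (n + 1) :: V) n q := by
        refine ⟨?_, hqn, fun y h1 h2 => ?_, fun h => ?_⟩
        · refine List.Perm.trans ?_ (perm_insert_max hpτ)
          have := List.perm_middle (a := n + 1) (l₁ := U ++ [z]) (l₂ := V)
          simpa using this
        · have hy := (hmemτ y).2 (by omega)
          have hyV : y ∉ V := fun h => hV y h h1
          simp only [List.mem_append, List.mem_cons, hyV, or_false] at hy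
          rw [eN, before_append]
          exact Or.inr (Or.inr ⟨by simpa using hy, by simp⟩)
        · rw [eN, before_append]
          exact Or.inr (Or.inl (before_cons.2 (Or.inl ⟨rfl, hqV h⟩)))
      exact ⟨_, hτ.insert_max hndτ hle hz (fun y hy => not_lt.1 (hV y hy)) hqV,
        hI.sim hI' (by rw [hfil]; exact hs)⟩
    have hnd : w.Nodup := hw.nodup_iff.2 List.nodup_range'
    rcases before_total (w := w) (x := n) (y := n + 1)
      (hw.mem_iff.2 (List.mem_range'_1.2 (by omega)))
      (hw.mem_iff.2 (List.mem_range'_1.2 (by omega))) (by omega) with h | h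
    · exact core w hw h
    · obtain ⟨τ, hτ, hs⟩ := core w.reverse ((List.reverse_perm w).trans hw) (before_reverse.2 h)
      exact ⟨τ.reverse, hτ.reverse, by simpa using hs.reverse⟩

theorem exists_isBaxter (σ : SPerm) : ∃ τ : SPerm, τ.IsBaxter ∧ Sim σ.1 τ.1 := by
  obtain ⟨τ, hb, hs⟩ := exists_wordBaxter _ σ.1 σ.2
  exact ⟨⟨τ, isPermWord_of_perm (hs.perm.symm.trans σ.2)⟩, isBaxter_iff.2 hb, hs⟩

/-! ### Connected permutations -/

/-- All the letters `≤ k` of `w` occur before all its letters `> k`. -/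
def Split (w : List ℕ) (k : ℕ) : Prop := ∀ a ∈ w, ∀ d ∈ w, a ≤ k → k < d → Before w a d

theorem exists_first_value {w : List ℕ} (hw : w.Nodup) {a d : ℕ} (ha : a ∈ w) (had : a ≤ d) :
    ∃ x ∈ w, a ≤ x ∧ x ≤ d ∧ ∀ z ∈ w, z ≠ x → a ≤ z → z ≤ d → Before w x z := by
  obtain ⟨U, z, V, e, hz, hV⟩ := exists_last_of_exists (p := fun x => a ≤ x ∧ x ≤ d)
    (l := w.reverse) ⟨a, by simpa using ha, le_rfl, had⟩
  have e' : w = V.reverse ++ z :: U.reverse := by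
    rw [← List.reverse_reverse w, e]
    simp
  refine ⟨z, by simp [e'], hz.1, hz.2, fun y hy hyz h1 h2 => ?_⟩
  rw [before_middle hw e']
  rw [e', List.mem_append, List.mem_cons] at hy
  exact (hy.resolve_left fun h => hV y (by simpa using h) ⟨h1, h2⟩).resolve_left hyz

/-- The splitting positions of a permutation are those of the Baxter permutation equivalent
to it. -/
theorem WordBaxter.split {μ τ : List ℕ} {k : ℕ} (hτ : WordBaxter τ) (hnd : τ.Nodup)
    (hs : Sim τ μ) (hk : Split μ k) : Split τ k := by
  by_contra hcon
  simp only [Split] at hcon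
  push Not at hcon
  obtain ⟨a₀, ha₀, d₀, hd₀, hak, hdk, hb⟩ := hcon
  rw [not_before_iff hnd ha₀ hd₀ (by omega)] at hb
  -- there are two adjacent letters `d > k` and `a ≤ k`
  obtain ⟨X, Y, d, a, rfl, hd, ha⟩ : ∃ X Y d a, τ = X ++ d :: a :: Y ∧ k < d ∧ a ≤ k := by
    obtain ⟨A, B, e⟩ := List.append_of_mem ha₀
    obtain ⟨U, d, V, eA, hd, hV⟩ := exists_last_of_exists (p := fun x => k < x) (l := A)
      ⟨d₀, (before_middle' hnd e).1 hb, hdk⟩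
    subst eA
    cases V with
    | nil => exact ⟨U, B, d, a₀, by simp [e], hd, hak⟩
    | cons a V => exact ⟨U, V ++ a₀ :: B, d, a, by simp [e], hd, not_lt.1 (hV a (by simp))⟩
  have hda := before_adjacent X Y d a
  have hndμ := hs.perm.nodup_iff.1 hnd
  have hma : a ∈ X ++ d :: a :: Y := hda.mem_right
  have hmd : d ∈ X ++ d :: a :: Y := hda.mem_left
  -- the first letter with value from `a` to `d` is at most `k`, the last one is larger than `k`
  obtain ⟨x, hx, hax, hxd, hxf⟩ := exists_first_value hnd hma (by omega : a ≤ d)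
  obtain ⟨y, hy, hay, hyd, hyl⟩ := exists_first_value (List.nodup_reverse.2 hnd)
    (List.mem_reverse.2 hma) (by omega : a ≤ d)
  simp only [List.mem_reverse, before_reverse] at hy hyl
  have hxa : x ≠ a := by
    rintro rfl
    exact hda.asymm hnd (hxf d hmd (by omega) (by omega) le_rfl)
  have hyd' : y ≠ d := by
    rintro rfl
    exact hda.asymm hnd (hyl a hma (by omega) le_rfl (by omega))
  have hxk : x ≤ k := by
    have h1 : First (X ++ d :: a :: Y) x a := fun z hz hzx h1 h2 =>
      hxf z hz hzx (by omega) (by omega)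
    rw [hs.first x hx a hma] at h1
    have h2 := h1 a (hs.perm.mem_iff.1 hma) hxa.symm (by omega) (by omega)
    by_contra hc
    exact h2.asymm hndμ (hk a h2.mem_right x h2.mem_left ha (by omega))
  have hyk : k < y := by
    have h1 : Last (X ++ d :: a :: Y) y d := fun z hz hzx h1 h2 =>
      hyl z hz hzx (by omega) (by omega)
    rw [hs.last y hy d hmd] at h1
    have h2 := h1 d (hs.perm.mem_iff.1 hmd) hyd'.symm (by omega) (by omega)
    by_contra hc
    exact h2.asymm hndμ (hk y h2.mem_right d h2.mem_left (by omega) hd)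
  have hxX : x ∈ X := (before_middle' hnd rfl).1 (hxf d hmd (by omega) (by omega) le_rfl)
  have hyY : y ∈ Y := by
    have e : X ++ d :: a :: Y = (X ++ [d]) ++ a :: Y := by simp
    exact (before_middle hnd e).1 (hyl a hma (by omega) le_rfl (by omega))
  exact (hτ X Y d a rfl x hxX y hyY).1 ⟨by omega, by omega, by omega⟩

theorem Split.of_invLE {w w' : List ℕ} {k : ℕ} (hw : w.Nodup) (hp : w.Perm w') (h : InvLE w w')
    (hk : Split w' k) : Split w k := by
  intro a ha d hd hak hkd
  rw [← not_before_iff hw hd ha (by omega)]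
  intro hda
  exact (hk a (hp.mem_iff.1 ha) d (hp.mem_iff.1 hd) hak hkd).asymm (hp.nodup_iff.1 hw)
    (h a d (by omega) hda)

theorem Split.eq_filter_append {w : List ℕ} {k : ℕ} (hw : w.Nodup) (h : Split w k) :
    w = w.filter (· ≤ k) ++ w.filter (k < ·) := by
  induction w with
  | nil => simp
  | cons a u ih =>
    have hau := List.nodup_cons.1 hw
    have hu : Split u k := by
      intro b hb d hd h1 h2
      have := h b (by simp [hb]) d (by simp [hd]) h1 h2
      rw [before_cons] at this
      exact this.resolve_left fun h => hau.1 (h.1 ▸ hb)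
    by_cases hak : a ≤ k
    · rw [List.filter_cons_of_pos (by simpa using hak),
        List.filter_cons_of_neg (by simpa using hak), List.cons_append, ← ih hau.2 hu]
    · have hall : ∀ b ∈ u, ¬ b ≤ k := by
        intro b hb hbk
        exact (h b (by simp [hb]) a (by simp) hbk (by omega)).asymm hw
          (before_cons.2 (Or.inl ⟨rfl, hb⟩))
      have h1 : (a :: u).filter (· ≤ k) = [] := by
        rw [List.filter_eq_nil_iff]
        intro b hb
        rw [List.mem_cons] at hb
        rcases hb with rfl | hb
        · simpa using hak
        · simpa using hall b hb
      have h2 : (a :: u).filter (k < ·) = a :: u := by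
        rw [List.filter_eq_self]
        intro b hb
        rw [List.mem_cons] at hb
        rcases hb with rfl | hb
        · simpa using hak
        · simpa using hall b hb
      rw [h1, h2, List.nil_append]

/-! ### Concatenation of permutations -/

theorem shift_perm_range' {v : List ℕ} (hv : IsPermWord v) (k : ℕ) :
    (shift k v).Perm (List.range' (k + 1) v.length) := by
  have h := hv.map (· + k)
  have e : (List.range' 1 v.length).map (· + k) = List.range' (k + 1) v.length := by
    rw [← List.map_add_range']
    exact List.map_congr_left fun x _ => add_comm x k
  rwa [e] at h

theorem length_shift (k : ℕ) (v : List ℕ) : (shift k v).length = v.length := by simp [shift]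

theorem length_slash (u v : List ℕ) : (slash u v).length = u.length + v.length := by
  simp [slash, shift]

theorem isPermWord_slash {u v : List ℕ} (hu : IsPermWord u) (hv : IsPermWord v) :
    IsPermWord (slash u v) := by
  refine isPermWord_of_perm (n := u.length + v.length) ?_
  rw [← List.range'_append_1, slash, add_comm 1 u.length]
  exact List.Perm.append hu (shift_perm_range' hv _)

/-- The permutation `σ ⟋ τ`. -/
def SPerm.slash (σ τ : SPerm) : SPerm := ⟨BaxterAlgebra.slash σ.1 τ.1, isPermWord_slash σ.2 τ.2⟩

theorem mem_shift {k x : ℕ} {v : List ℕ} (hv : IsPermWord v) (hx : x ∈ shift k v) : k < x := by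
  rw [(shift_perm_range' hv k).mem_iff, List.mem_range'_1] at hx
  omega

theorem nodup_shift {v : List ℕ} (hv : IsPermWord v) (k : ℕ) : (shift k v).Nodup :=
  (shift_perm_range' hv k).nodup_iff.2 List.nodup_range'

theorem before_shift {k : ℕ} {v : List ℕ} {x y : ℕ} :
    Before (shift k v) (x + k) (y + k) ↔ Before v x y := by
  induction v with
  | nil => simp [shift, not_before_nil]
  | cons a v ih =>
    have e : shift k (a :: v) = (a + k) :: shift k v := rfl
    rw [e, before_cons, before_cons, ih]
    simp [shift]

theorem shift_injective (k : ℕ) : Function.Injective (shift k) :=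
  List.map_injective_iff.2 (add_left_injective k)

/-- A permutation decomposes into its restriction to the letters `≤ k` and its (standardized)
restriction to the letters `> k`. -/
theorem exists_restrictions (σ : SPerm) {k : ℕ} (hk : k ≤ σ.1.length) :
    ∃ ν π : SPerm, ν.1.length = k ∧ ν.1.length + π.1.length = σ.1.length ∧
      σ.1.filter (· ≤ k) = ν.1 ∧ σ.1.filter (k < ·) = shift k π.1 := by
  have h1 : (σ.1.filter (· ≤ k)).Perm (List.range' 1 k) := by
    refine (List.perm_ext_iff_of_nodup (σ.2.nodup.filter _) List.nodup_range').2 fun x => ?_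
    rw [List.mem_filter, σ.2.mem_iff, List.mem_range'_1, decide_eq_true_eq]
    omega
  have h2 : (σ.1.filter (k < ·)).Perm (List.range' (k + 1) (σ.1.length - k)) := by
    refine (List.perm_ext_iff_of_nodup (σ.2.nodup.filter _) List.nodup_range').2 fun x => ?_
    rw [List.mem_filter, σ.2.mem_iff, List.mem_range'_1, decide_eq_true_eq]
    omega
  have h3 : ((σ.1.filter (k < ·)).map (· - k)).Perm (List.range' 1 (σ.1.length - k)) := by
    have := h2.map (· - k)
    have e : (List.range' (k + 1) (σ.1.length - k)).map (· - k) =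
        List.range' 1 (σ.1.length - k) := by
      rw [← List.map_add_range', List.map_map]
      exact (List.map_congr_left fun x _ => Nat.add_sub_cancel_left k x).trans (List.map_id _)
    rwa [e] at this
  refine ⟨⟨_, isPermWord_of_perm h1⟩, ⟨_, isPermWord_of_perm h3⟩, ?_, ?_, rfl, ?_⟩
  · simpa using h1.length_eq
  · have e1 := h1.length_eq
    have e3 := h3.length_eq
    rw [List.length_range'] at e1 e3
    rw [e1, e3]
    omega
  · rw [shift, List.map_map]
    symm
    refine (List.map_congr_left fun x hx => ?_).trans (List.map_id _)
    rw [List.mem_filter, decide_eq_true_eq] at hx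
    simp only [Function.comp, id]
    omega

theorem split_slash (σ τ : SPerm) : Split (slash σ.1 τ.1) σ.1.length := by
  intro a ha d hd hak hkd
  rw [slash, before_append]
  rw [slash, List.mem_append] at ha hd
  refine Or.inr (Or.inr ⟨ha.resolve_right fun h => ?_, hd.resolve_left fun h => ?_⟩)
  · have := mem_shift τ.2 h
    omega
  · have := σ.2.mem_iff.1 h
    omega

theorem Split.exists_slash {σ : SPerm} {k : ℕ} (h : Split σ.1 k) (hk : k ≤ σ.1.length) :
    ∃ ν π : SPerm, ν.1.length = k ∧ σ = ν.slash π := by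
  obtain ⟨ν, π, h1, -, h3, h4⟩ := exists_restrictions σ hk
  refine ⟨ν, π, h1, Subtype.ext ?_⟩
  rw [h.eq_filter_append σ.2.nodup, h3, h4, ← h1]
  rfl

/-- For `j` at most the size of `σ`, the permutation `σ ⟋ τ` splits at `j` exactly when `σ`
does. -/
theorem split_slash_iff {σ τ : SPerm} {j : ℕ} (hj : j ≤ σ.1.length) :
    Split (slash σ.1 τ.1) j ↔ Split σ.1 j := by
  constructor
  · intro h a ha d hd hak hkd
    have := h a (by simp [slash, ha]) d (by simp [slash, hd]) hak hkd
    rw [slash, before_append] at this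
    have ha' := σ.2.mem_iff.1 ha
    have hd' := σ.2.mem_iff.1 hd
    refine this.resolve_right ?_
    rintro (h | ⟨-, h⟩)
    · have := mem_shift τ.2 h.mem_left
      omega
    · have := mem_shift τ.2 h
      omega
  · intro h a ha d hd hak hkd
    rw [slash, List.mem_append] at ha hd
    have ha' := ha.resolve_right fun h => by
      have := mem_shift τ.2 h
      omega
    rw [slash, before_append]
    rcases hd with hd | hd
    · exact Or.inl (h a ha' d hd hak hkd)
    · exact Or.inr (Or.inr ⟨ha', hd⟩)

theorem SPerm.eq_empty_iff {σ : SPerm} : σ = SPerm.empty ↔ σ.1.length = 0 := by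
  rw [List.length_eq_zero_iff, Subtype.ext_iff]
  rfl

theorem isConnected_iff {σ : SPerm} :
    σ.IsConnected ↔ 0 < σ.1.length ∧ ∀ k, 0 < k → k < σ.1.length → ¬ Split σ.1 k := by
  rw [SPerm.IsConnected, Ne, SPerm.eq_empty_iff, ← Ne, ← Nat.pos_iff_ne_zero]
  refine and_congr_right fun _ => ⟨fun h k hk hkn hs => ?_, fun h ν π e => ?_⟩
  · obtain ⟨ν, π, h1, h2⟩ := hs.exists_slash hkn.le
    have hl := congrArg (fun τ : SPerm => τ.1.length) h2
    simp only [SPerm.slash, length_slash] at hl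
    rcases h ν π (congrArg Subtype.val h2) with rfl | rfl <;> omega
  · have hl := congrArg List.length e
    rw [length_slash] at hl
    by_contra hcon
    rw [not_or] at hcon
    have h0 : ν.1.length ≠ 0 := by
      intro h0
      refine hcon.2 (Subtype.ext ?_)
      rw [List.length_eq_zero_iff] at h0
      simp [e, h0, slash, shift]
    have h1 : π.1.length ≠ 0 := by
      intro h1
      refine hcon.1 (Subtype.ext ?_)
      rw [List.length_eq_zero_iff] at h1
      simp [e, h1, slash, shift]
    exact h ν.1.length (by omega) (by omega) (e ▸ split_slash ν π)

theorem SPerm.IsConnected.slash_inj {μ μ' ρ ρ' : SPerm} (h : μ.IsConnected)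
    (h' : μ'.IsConnected) (e : μ.slash ρ = μ'.slash ρ') : μ = μ' ∧ ρ = ρ' := by
  have e1 : BaxterAlgebra.slash μ.1 ρ.1 = BaxterAlgebra.slash μ'.1 ρ'.1 := congrArg Subtype.val e
  rw [isConnected_iff] at h h'
  have hl : μ.1.length = μ'.1.length := by
    rcases lt_trichotomy μ.1.length μ'.1.length with hlt | heq | hlt
    · exact absurd ((split_slash_iff hlt.le).1 (e1 ▸ split_slash μ ρ)) (h'.2 _ h.1 hlt)
    · exact heq
    · exact absurd ((split_slash_iff hlt.le).1 (e1 ▸ split_slash μ' ρ')) (h.2 _ h'.1 hlt)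
  obtain ⟨h1, h2⟩ := List.append_inj e1 hl
  rw [hl] at h2
  exact ⟨Subtype.ext h1, Subtype.ext (shift_injective _ h2)⟩

theorem bottom_slash_iff {σ τ : SPerm} :
    Bottom (slash σ.1 τ.1) ↔ Bottom σ.1 ∧ Bottom τ.1 := by
  constructor
  · refine fun h => ⟨fun X Y d a e had => ?_, fun X Y d a e had => ?_⟩
    · rcases h X (Y ++ shift σ.1.length τ.1) d a (by simp [slash, e]) had with h | h
      · exact Or.inl h
      · exact Or.inr fun s hs => h s (by simp [hs])
    · have e' : slash σ.1 τ.1 = (σ.1 ++ shift σ.1.length X) ++ (d + σ.1.length) ::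
          (a + σ.1.length) :: shift σ.1.length Y := by simp [slash, e, shift]
      rcases h _ _ _ _ e' (by omega) with h | h
      · refine Or.inl fun p hp h1 => h (p + σ.1.length) ?_ (by omega)
        exact List.mem_append_right _ (List.mem_map_of_mem hp)
      · exact Or.inr fun s hs h1 => h (s + σ.1.length) (List.mem_map_of_mem hs) (by omega)
  · rintro ⟨hσ, hτ⟩ X Y d a e had
    rw [slash, List.append_eq_append_iff] at e
    rcases e with ⟨Z, rfl, e⟩ | ⟨Z, e1, e⟩
    · obtain ⟨X₁, Y₁, e1, rfl, e2⟩ := List.map_eq_append_iff.1 e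
      obtain ⟨d₁, Y₂, rfl, rfl, e3⟩ := List.map_eq_cons_iff.1 e2
      obtain ⟨a₁, Y₃, rfl, rfl, rfl⟩ := List.map_eq_cons_iff.1 e3
      rcases hτ X₁ Y₃ d₁ a₁ e1 (by omega) with h | h
      · refine Or.inl fun p hp h1 => ?_
        rw [List.mem_append, List.mem_map] at hp
        rcases hp with hp | ⟨p, hp, rfl⟩
        · have := σ.2.mem_iff.1 hp
          omega
        · exact h p hp (by omega)
      · refine Or.inr fun s hs h1 => ?_
        obtain ⟨s', hs', rfl⟩ := List.mem_map.1 hs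
        exact h s' hs' (by omega)
    · cases Z with
      | nil =>
        simp only [List.append_nil, List.nil_append] at e e1
        subst e1
        obtain ⟨d₁, Y₂, e1, rfl, e3⟩ := List.map_eq_cons_iff.1 e.symm
        obtain ⟨a₁, Y₃, rfl, rfl, rfl⟩ := List.map_eq_cons_iff.1 e3
        rcases hτ [] Y₃ d₁ a₁ e1 (by omega) with h | h
        · refine Or.inl fun p hp h1 => ?_
          have := σ.2.mem_iff.1 hp
          omega
        · refine Or.inr fun s hs h1 => ?_
          obtain ⟨s', hs', rfl⟩ := List.mem_map.1 hs
          exact h s' hs' (by omega)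
      | cons c Z =>
        simp only [List.cons_append, List.cons.injEq] at e
        obtain ⟨rfl, e⟩ := e
        have hd := σ.2.mem_iff.1 (show d ∈ σ.1 by simp [e1])
        cases Z with
        | nil =>
          have := mem_shift (k := σ.1.length) (x := a) τ.2 (by
            rw [List.nil_append] at e
            rw [← e]
            simp)
          omega
        | cons c Z =>
          simp only [List.cons_append, List.cons.injEq] at e
          obtain ⟨rfl, rfl⟩ := e
          rcases hσ X Z d a e1 had with h | h
          · exact Or.inl h
          · refine Or.inr fun s hs h1 => ?_
            rw [List.mem_append] at hs
            rcases hs with hs | hs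
            · exact h s hs h1
            · have := mem_shift τ.2 hs
              omega

/-! ### The shifted shuffle of two permutations -/

theorem mem_shuffle_iff (p : ℕ → Bool) : ∀ (u v x : List ℕ), (∀ a ∈ u, p a = true) →
    (∀ b ∈ v, p b = false) → (x ∈ shuffle u v ↔ x.filter p = u ∧ x.filter (fun c => !p c) = v)
  | [], v, x, _, hv => by
    rw [shuffle_nil_left, Multiset.mem_singleton]
    constructor
    · rintro rfl
      rw [List.filter_eq_nil_iff, List.filter_eq_self]
      exact ⟨fun a ha => by simp [hv a ha], fun a ha => by simp [hv a ha]⟩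
    · rintro ⟨h1, h2⟩
      rw [List.filter_eq_nil_iff] at h1
      rw [← h2, eq_comm, List.filter_eq_self]
      intro a ha
      simpa using h1 a ha
  | a :: u, [], x, hu, _ => by
    rw [shuffle_nil_right, Multiset.mem_singleton]
    constructor
    · rintro rfl
      rw [List.filter_eq_nil_iff, List.filter_eq_self]
      exact ⟨hu, fun b hb => by simp [hu b hb]⟩
    · rintro ⟨h1, h2⟩
      rw [List.filter_eq_nil_iff] at h2
      rw [← h1, eq_comm, List.filter_eq_self]
      intro b hb
      simpa using h2 b hb
  | a :: u, b :: v, x, hu, hv => by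
    have ha := hu a (by simp)
    have hb := hv b (by simp)
    have hu' : ∀ c ∈ u, p c = true := fun c hc => hu c (by simp [hc])
    have hv' : ∀ c ∈ v, p c = false := fun c hc => hv c (by simp [hc])
    rw [shuffle_cons, Multiset.mem_add, Multiset.mem_map, Multiset.mem_map]
    cases x with
    | nil => simp
    | cons c x =>
      have h1 := mem_shuffle_iff p u (b :: v) x hu' hv
      have h2 := mem_shuffle_iff p (a :: u) v x hu hv'
      simp only [List.cons.injEq]
      by_cases hc : p c = true
      · have hcb : b ≠ c := by rintro rfl; simp [hb] at hc
        rw [List.filter_cons_of_pos hc, List.filter_cons_of_neg (by simp [hc]), List.cons.injEq]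
        constructor
        · rintro (⟨y, hy, rfl, rfl⟩ | ⟨y, hy, h, -⟩)
          · have := h1.1 hy
            exact ⟨⟨rfl, this.1⟩, this.2⟩
          · exact absurd h hcb
        · rintro ⟨⟨rfl, h3⟩, h4⟩
          exact Or.inl ⟨x, h1.2 ⟨h3, h4⟩, rfl, rfl⟩
      · have hca : a ≠ c := by rintro rfl; exact hc ha
        rw [List.filter_cons_of_neg hc, List.filter_cons_of_pos (by simp [hc]), List.cons.injEq]
        constructor
        · rintro (⟨y, hy, h, -⟩ | ⟨y, hy, rfl, rfl⟩)
          · exact absurd h hca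
          · have := h2.1 hy
            exact ⟨this.1, rfl, this.2⟩
        · rintro ⟨h3, rfl, h4⟩
          exact Or.inr ⟨x, h2.2 ⟨h3, h4⟩, rfl, rfl⟩
  termination_by u v => u.length + v.length

theorem nodup_shuffle : ∀ (u v : List ℕ), u.Disjoint v → (shuffle u v).Nodup
  | [], v, _ => by rw [shuffle_nil_left]; exact Multiset.nodup_singleton v
  | a :: u, [], _ => by rw [shuffle_nil_right]; exact Multiset.nodup_singleton _
  | a :: u, b :: v, h => by
    have h1 := nodup_shuffle u (b :: v) (List.disjoint_of_disjoint_cons_left h)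
    have h2 := nodup_shuffle (a :: u) v (List.disjoint_of_disjoint_cons_right h)
    rw [shuffle_cons, Multiset.nodup_add]
    refine ⟨h1.map (List.cons_injective), h2.map (List.cons_injective), ?_⟩
    rw [Multiset.disjoint_left]
    intro x hx hx'
    obtain ⟨y, -, rfl⟩ := Multiset.mem_map.1 hx
    obtain ⟨z, -, e⟩ := Multiset.mem_map.1 hx'
    simp only [List.cons.injEq] at e
    exact h (a := a) (by simp) (by simp [e.1])
  termination_by u v => u.length + v.length

theorem nodup_shiftedShuffle (ν ρ : SPerm) : (shiftedShuffle ν ρ).Nodup := by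
  refine Multiset.Nodup.of_map Subtype.val ?_
  rw [map_val_shiftedShuffle]
  refine nodup_shuffle _ _ fun x hx hx' => ?_
  have h1 := ν.2.mem_iff.1 hx
  have h2 := mem_shift ρ.2 hx'
  omega

theorem mem_shiftedShuffle_iff {ν ρ π : SPerm} : π ∈ shiftedShuffle ν ρ ↔
    π.1.filter (· ≤ ν.1.length) = ν.1 ∧
      π.1.filter (ν.1.length < ·) = shift ν.1.length ρ.1 := by
  rw [← Multiset.mem_map_of_injective Subtype.val_injective, map_val_shiftedShuffle,
    wordShiftedShuffle, mem_shuffle_iff (fun x => decide (x ≤ ν.1.length))]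
  · have e : (fun c => !decide (c ≤ ν.1.length)) = fun c => decide (ν.1.length < c) := by
      ext c
      rw [← decide_not, decide_eq_decide]
      exact not_le
    rw [e]
  · intro a ha
    simpa using (ν.2.mem_iff.1 ha).2
  · intro b hb
    simpa using mem_shift ρ.2 hb

theorem invLE_slash_iff {σ τ ν ρ π : SPerm} (hl : ν.1.length = σ.1.length)
    (hπ : π ∈ shiftedShuffle ν ρ) :
    InvLE (slash σ.1 τ.1) π.1 ↔ InvLE σ.1 ν.1 ∧ InvLE τ.1 ρ.1 := by
  rw [mem_shiftedShuffle_iff, hl] at hπ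
  constructor
  · refine fun h => ⟨fun a b hab hba => ?_, fun a b hab hba => ?_⟩
    · rw [← hπ.1, before_filter]
      have h1 := σ.2.mem_iff.1 hba.mem_left
      have h2 := σ.2.mem_iff.1 hba.mem_right
      refine ⟨h a b hab ?_, by simp; omega, by simp; omega⟩
      rw [slash, before_append]
      exact Or.inl hba
    · rw [← before_shift (k := σ.1.length), ← hπ.2, before_filter]
      have h1 := τ.2.mem_iff.1 hba.mem_left
      have h2 := τ.2.mem_iff.1 hba.mem_right
      refine ⟨h _ _ (by omega) ?_, by simp; omega, by simp; omega⟩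
      rw [slash, before_append]
      exact Or.inr (Or.inl (before_shift.2 hba))
  · rintro ⟨h1, h2⟩ a b hab hba
    rw [slash, before_append] at hba
    rcases hba with h | h | ⟨hb, ha⟩
    · have h3 := h1 a b hab h
      rw [← hπ.1, before_filter] at h3
      exact h3.1
    · obtain ⟨b', hb', rfl⟩ := List.mem_map.1 h.mem_left
      obtain ⟨a', ha', rfl⟩ := List.mem_map.1 h.mem_right
      have h3 := h2 a' b' (by omega) (before_shift.1 h)
      rw [← before_shift (k := σ.1.length), ← hπ.2, before_filter] at h3
      exact h3.1
    · have h3 := σ.2.mem_iff.1 hb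
      have h4 := mem_shift τ.2 ha
      omega

/-! ### The multiplicative basis of `FQSym` -/

open Classical in
/-- The permutations that are greater than or equal to `σ` in the permutohedron order. -/
noncomputable def upperSet (σ : SPerm) : Finset SPerm :=
  (permsOfSize σ.1.length).filter fun ν => InvLE σ.1 ν.1

theorem mem_upperSet {σ ν : SPerm} :
    ν ∈ upperSet σ ↔ ν.1.length = σ.1.length ∧ InvLE σ.1 ν.1 := by
  simp only [upperSet, Finset.mem_filter, mem_permsOfSize]

theorem SPerm.perm_of_length_eq {σ ν : SPerm} (h : ν.1.length = σ.1.length) : σ.1.Perm ν.1 :=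
  List.Perm.trans σ.2 (by rw [← h]; exact List.Perm.symm ν.2)

theorem mem_upperSet_iff_permLE {σ ν : SPerm} : ν ∈ upperSet σ ↔ σ.PermLE ν := by
  rw [mem_upperSet, permLE_iff]
  exact and_congr_left fun _ => ⟨SPerm.perm_of_length_eq, fun h => h.length_eq.symm⟩

theorem self_mem_upperSet (σ : SPerm) : σ ∈ upperSet σ := mem_upperSet.2 ⟨rfl, InvLE.refl _⟩

theorem upperSet_subset {σ ν : SPerm} (h : ν ∈ upperSet σ) : upperSet ν ⊆ upperSet σ := by
  intro ρ hρ
  rw [mem_upperSet] at *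
  exact ⟨hρ.1.trans h.1, h.2.trans hρ.2⟩

theorem eq_of_mem_upperSet {σ ν : SPerm} (h : ν ∈ upperSet σ) (h' : σ ∈ upperSet ν) : σ = ν := by
  rw [mem_upperSet] at *
  exact Subtype.ext (InvLE.antisymm σ.2.nodup (SPerm.perm_of_length_eq h.1) h.2 h'.2)

theorem card_upperSet_lt {σ ν : SPerm} (h : ν ∈ upperSet σ) (hne : σ ≠ ν) :
    (upperSet ν).card < (upperSet σ).card :=
  Finset.card_lt_card ⟨upperSet_subset h, fun h' =>
    hne (eq_of_mem_upperSet h (h' (self_mem_upperSet σ)))⟩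

variable (K : Type*) [Field K]

/-- The sum of the `F ν` over the permutations `ν ≥ σ`. -/
noncomputable def upperSum (σ : SPerm) : FQSym K := ∑ ν ∈ upperSet σ, FQSym.F K ν

theorem upperSum_empty : upperSum K SPerm.empty = 1 := by
  have : upperSet SPerm.empty = {SPerm.empty} := by
    ext ν
    rw [mem_upperSet, Finset.mem_singleton]
    constructor
    · exact fun h => SPerm.eq_empty_iff.2 h.1
    · rintro rfl
      exact ⟨rfl, InvLE.refl _⟩
  rw [upperSum, this, Finset.sum_singleton, FQSym.one_eq_F]

/-- The permutations above `σ ⟋ τ` are the shifted shuffles of a permutation above `σ` and of a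
permutation above `τ`. -/
theorem upperSum_mul (σ τ : SPerm) :
    upperSum K σ * upperSum K τ = upperSum K (σ.slash τ) := by
  classical
  have h1 : upperSum K σ * upperSum K τ = ∑ q ∈ upperSet σ ×ˢ upperSet τ,
      ∑ π ∈ (shiftedShuffle q.1 q.2).toFinset, FQSym.F K π := by
    rw [upperSum, upperSum, Finset.sum_mul_sum, Finset.sum_product]
    refine Finset.sum_congr rfl fun ν _ => Finset.sum_congr rfl fun ρ _ => ?_
    rw [FQSym.F_mul_F, Finset.sum, Multiset.toFinset_val, (nodup_shiftedShuffle ν ρ).dedup]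
  rw [h1, ← Finset.sum_biUnion]
  · rw [upperSum]
    refine Finset.sum_congr ?_ fun _ _ => rfl
    ext π
    simp only [Finset.mem_biUnion, Finset.mem_product, Multiset.mem_toFinset, mem_upperSet,
      SPerm.slash, length_slash]
    constructor
    · rintro ⟨⟨ν, ρ⟩, ⟨⟨hν, hν'⟩, ⟨hρ, hρ'⟩⟩, hπ⟩
      refine ⟨?_, (invLE_slash_iff hν hπ).2 ⟨hν', hρ'⟩⟩
      have h2 := Multiset.mem_map_of_mem Subtype.val hπ
      rw [map_val_shiftedShuffle] at h2
      rw [length_of_mem_shuffle h2, length_shift]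
      exact congrArg₂ (· + ·) hν hρ
    · rintro ⟨hl, hle⟩
      obtain ⟨ν, ρ, h2, h3, h4, h5⟩ := exists_restrictions π (k := σ.1.length) (by omega)
      have hπ : π ∈ shiftedShuffle ν ρ := by
        rw [mem_shiftedShuffle_iff, h2]
        exact ⟨h4, h5⟩
      have h6 := (invLE_slash_iff h2 hπ).1 hle
      exact ⟨(ν, ρ), ⟨⟨h2, h6.1⟩, ⟨by dsimp only; omega, h6.2⟩⟩, hπ⟩
  · rintro ⟨ν, ρ⟩ hq ⟨ν', ρ'⟩ hq' hne
    rw [Finset.mem_coe, Finset.mem_product, mem_upperSet, mem_upperSet] at hq hq'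
    rw [Function.onFun, Finset.disjoint_left]
    intro π hπ hπ'
    rw [Multiset.mem_toFinset, mem_shiftedShuffle_iff] at hπ hπ'
    have hl : ν'.1.length = ν.1.length := hq'.1.1.trans hq.1.1.symm
    dsimp only at hπ hπ'
    rw [hl] at hπ'
    refine hne (Prod.ext (Subtype.ext (hπ.1.symm.trans hπ'.1))
      (Subtype.ext (shift_injective _ (hπ.2.symm.trans hπ'.2))))

theorem repr_upperSum [DecidableEq SPerm] (σ ν : SPerm) :
    (FQSym.F K).repr (upperSum K σ) ν = if ν ∈ upperSet σ then 1 else 0 := by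
  rw [upperSum, map_sum, Finsupp.finsetSum_apply]
  simp only [Module.Basis.repr_self, Finsupp.single_apply]
  rw [Finset.sum_ite_eq' (upperSet σ) ν (fun _ => (1 : K))]

theorem linearIndependent_upperSum : LinearIndependent K (upperSum K) := by
  classical
  rw [linearIndependent_iff']
  intro s g hg
  by_contra hcon
  push Not at hcon
  obtain ⟨σ₀, hσ₀, hg₀⟩ := hcon
  -- the permutation of the support with the most permutations above it is minimal in the support
  obtain ⟨σ, hσ, hmax⟩ := Finset.exists_max_image (s.filter fun σ => g σ ≠ 0)
    (fun σ => (upperSet σ).card) ⟨σ₀, Finset.mem_filter.2 ⟨hσ₀, hg₀⟩⟩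
  rw [Finset.mem_filter] at hσ
  have h := congrArg (fun x => (FQSym.F K).repr x σ) hg
  simp only [map_sum, map_smul, Finsupp.finsetSum_apply, Finsupp.smul_apply, repr_upperSum,
    map_zero, Finsupp.zero_apply, smul_eq_mul] at h
  rw [Finset.sum_eq_single σ] at h
  · rw [if_pos (self_mem_upperSet σ), mul_one] at h
    exact hσ.2 h
  · intro τ hτ hτσ
    by_cases hgτ : g τ = 0
    · rw [hgτ, zero_mul]
    · rw [if_neg, mul_zero]
      intro hmem
      have h1 := card_upperSet_lt hmem hτσ
      have h2 := hmax τ (Finset.mem_filter.2 ⟨hτ, hgτ⟩)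
      omega
  · exact fun hσ' => absurd hσ.1 hσ'

/-! ### The subspace `Baxter` -/

theorem twins_eq_iff_pShape {σ : SPerm} {J : TBT} : twins σ = J ↔ pShape σ.1 = J.1 :=
  Subtype.ext_iff

/-- As the order of twin binary trees is induced by the permutohedron, the element `E_J` is the
sum over all the permutations above the smallest permutation whose `ℙ`-symbol is `J`. -/
theorem E_twins {μ : SPerm} (hμ : Bottom μ.1) : E K (twins μ) = upperSum K μ := by
  classical
  rw [E, upperSum, ← Finset.sum_fiberwise_of_maps_to (g := twins)
    (t := (twinsOfSize (twins μ).size).filter fun J' => (twins μ).LE J')]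
  · refine Finset.sum_congr (by congr) fun J' hJ' => ?_
    rw [Finset.mem_filter, mem_twinsOfSize, twins_size] at hJ'
    obtain ⟨hsize, σ₀, σ₁, h₀, h₁, hle⟩ := hJ'
    rw [P]
    refine Finset.sum_congr ?_ fun _ _ => rfl
    ext σ
    rw [Finset.mem_filter, Finset.mem_filter, mem_permsOfSize, mem_upperSet, twins_eq_iff_pShape,
      hsize]
    refine ⟨fun h => ⟨⟨h.1, ?_⟩, h.2⟩, fun h => ⟨h.1.1, h.2⟩⟩
    rw [permLE_iff] at hle
    refine hμ.invLE_of_sim μ.2.nodup ?_ hle.1 hle.2 ?_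
    · rw [← twins_eq_iff, eq_comm, twins_eq_iff_pShape, h₀]
    · rw [← pShape_eq_iff, h₁, h.2]
  · intro σ hσ
    rw [Finset.mem_filter, mem_twinsOfSize, twins_size, twins_size]
    exact ⟨(mem_upperSet.1 hσ).1, μ, σ, rfl, rfl, mem_upperSet_iff_permLE.1 hσ⟩

theorem exists_bottom_twins (σ : SPerm) : ∃ μ : SPerm, Bottom μ.1 ∧ twins μ = twins σ := by
  obtain ⟨μ, hμ, hs⟩ := exists_bottom_sperm σ
  exact ⟨μ, hμ, twins_eq_iff.2 hs.symm⟩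

theorem eq_of_bottom_of_twins_eq {μ ν : SPerm} (hμ : Bottom μ.1) (hν : Bottom ν.1)
    (h : twins μ = twins ν) : μ = ν :=
  Subtype.ext (hμ.eq_of_sim μ.2.nodup hν (twins_eq_iff.1 h))

theorem P_eq_zero {J : TBT} (h : ∀ σ : SPerm, twins σ ≠ J) : P K J = 0 := by
  rw [P, Finset.filter_eq_empty_iff.2, Finset.sum_empty]
  exact fun σ _ hσ => h σ (twins_eq_iff_pShape.2 hσ)

theorem P_twins_mem_span (n : ℕ) (μ : SPerm) (hμ : Bottom μ.1) (hn : (upperSet μ).card = n) :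
    P K (twins μ) ∈ Submodule.span K (Set.range fun ν : {ν : SPerm // Bottom ν.1} =>
      upperSum K ν.1) := by
  classical
  induction n using Nat.strong_induction_on generalizing μ with
  | _ n ih =>
    have hself : twins μ ∈ (twinsOfSize (twins μ).size).filter fun J' => (twins μ).LE J' := by
      rw [Finset.mem_filter, mem_twinsOfSize]
      exact ⟨rfl, μ, μ, rfl, rfl, Relation.ReflTransGen.refl⟩
    have hE : E K (twins μ) =
        ∑ J' ∈ twinsOfSize (twins μ).size with (twins μ).LE J', P K J' := by
      rw [E]
    rw [← Finset.add_sum_erase _ _ hself] at hE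
    rw [← sub_eq_iff_eq_add.2 hE]
    refine Submodule.sub_mem _ ?_ (Submodule.sum_mem _ fun J' hJ' => ?_)
    · rw [E_twins K hμ]
      exact Submodule.subset_span ⟨⟨μ, hμ⟩, rfl⟩
    · by_cases hJ : ∃ σ : SPerm, twins σ = J'
      · obtain ⟨σ, rfl⟩ := hJ
        obtain ⟨ν, hν, e⟩ := exists_bottom_twins σ
        rw [Finset.mem_erase, Finset.mem_filter, mem_twinsOfSize] at hJ'
        obtain ⟨hne, hsize, σ₀, σ₁, h₀, h₁, hle⟩ := hJ'
        rw [twins_size, twins_size] at hsize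
        rw [permLE_iff] at hle
        rw [← e] at hne h₁ ⊢
        have hs₁ : Sim σ₁.1 ν.1 := twins_eq_iff.1 (twins_eq_iff_pShape.2 h₁)
        have hs₀ : Sim μ.1 σ₀.1 := (twins_eq_iff.1 (twins_eq_iff_pShape.2 h₀)).symm
        have hmem : ν ∈ upperSet μ := mem_upperSet.2
          ⟨((hs₀.perm.trans hle.1).trans hs₁.perm).length_eq.symm,
            hμ.invLE_of_sim μ.2.nodup hs₀ hle.1 hle.2 hs₁⟩
        exact ih _ (hn ▸ card_upperSet_lt hmem fun h => hne (by rw [h])) ν hν rfl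
      · push Not at hJ
        rw [P_eq_zero K hJ]
        exact Submodule.zero_mem _

theorem baxterSpan_eq : baxterSpan K =
    Submodule.span K (Set.range fun ν : {ν : SPerm // Bottom ν.1} => upperSum K ν.1) := by
  apply le_antisymm
  · rw [baxterSpan, Submodule.span_le]
    rintro _ ⟨J, rfl⟩
    by_cases hJ : ∃ σ : SPerm, twins σ = J
    · obtain ⟨σ, rfl⟩ := hJ
      obtain ⟨μ, hμ, e⟩ := exists_bottom_twins σ
      rw [← e]
      exact P_twins_mem_span K _ μ hμ rfl
    · push Not at hJ
      rw [P_eq_zero K hJ]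
      exact Submodule.zero_mem _
  · rw [Submodule.span_le]
    rintro _ ⟨ν, rfl⟩
    dsimp only
    rw [← E_twins K ν.2, E]
    exact Submodule.sum_mem _ fun J _ => Submodule.subset_span ⟨J, rfl⟩

/-! ### Connected pairs of twin binary trees -/

/-- A pair of twin binary trees is connected exactly when the smallest permutation with this
`ℙ`-symbol is. -/
theorem isConnected_twins_iff {μ : SPerm} (hμ : Bottom μ.1) :
    (twins μ).IsConnected ↔ μ.IsConnected := by
  have aux : ∀ τ : SPerm, τ.IsBaxter → Sim τ.1 μ.1 → (τ.IsConnected ↔ μ.IsConnected) := by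
    intro τ hτ hs
    rw [isConnected_iff, isConnected_iff, hs.perm.length_eq]
    refine and_congr_right fun _ => forall_congr' fun k => forall_congr' fun _ =>
      forall_congr' fun _ => not_congr ⟨?_, ?_⟩
    · exact Split.of_invLE μ.2.nodup hs.perm.symm (hμ.invLE_sim μ.2.nodup hs.symm)
    · exact (isBaxter_iff.1 hτ).split τ.2.nodup hs
  constructor
  · rintro ⟨τ, hτ, h, hc⟩
    exact (aux τ hτ (twins_eq_iff.1 (twins_eq_iff_pShape.2 h))).1 hc
  · intro hc
    obtain ⟨τ, hτ, hs⟩ := exists_isBaxter μ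
    exact ⟨τ, hτ, twins_eq_iff_pShape.1 (twins_eq_iff.2 hs.symm), (aux τ hτ hs.symm).2 hc⟩

theorem exists_minPerm (J : {J : TBT // J.IsConnected}) :
    ∃ μ : SPerm, Bottom μ.1 ∧ twins μ = J.1 := by
  obtain ⟨J, σ, -, h, -⟩ := J
  obtain ⟨μ, hμ, e⟩ := exists_bottom_twins σ
  exact ⟨μ, hμ, e.trans (twins_eq_iff_pShape.2 h)⟩

/-- The smallest permutation with a given connected `ℙ`-symbol. -/
noncomputable def minPerm (J : {J : TBT // J.IsConnected}) : SPerm := (exists_minPerm J).choose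

theorem bottom_minPerm (J : {J : TBT // J.IsConnected}) : Bottom (minPerm J).1 :=
  (exists_minPerm J).choose_spec.1

theorem twins_minPerm (J : {J : TBT // J.IsConnected}) : twins (minPerm J) = J.1 :=
  (exists_minPerm J).choose_spec.2

theorem isConnected_minPerm (J : {J : TBT // J.IsConnected}) : (minPerm J).IsConnected := by
  rw [← isConnected_twins_iff (bottom_minPerm J), twins_minPerm]
  exact J.2

/-- The iterated concatenation of the smallest permutations of a sequence of connected pairs. -/
noncomputable def slashList (l : List {J : TBT // J.IsConnected}) : SPerm :=
  l.foldr (fun J σ => (minPerm J).slash σ) SPerm.empty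

theorem slashList_cons (J : {J : TBT // J.IsConnected}) (l : List {J : TBT // J.IsConnected}) :
    slashList (J :: l) = (minPerm J).slash (slashList l) := rfl

theorem slashList_injective : Function.Injective slashList := by
  have hne : ∀ J l, slashList (J :: l) ≠ SPerm.empty := by
    intro J l h
    rw [SPerm.eq_empty_iff, slashList_cons, SPerm.slash, length_slash] at h
    have := (isConnected_iff.1 (isConnected_minPerm J)).1
    omega
  intro l
  induction l with
  | nil =>
    intro l' h
    cases l' with
    | nil => rfl
    | cons J l' => exact absurd h.symm (hne J l')
  | cons J l ih =>
    intro l' h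
    cases l' with
    | nil => exact absurd h (hne J l)
    | cons J' l' =>
      obtain ⟨h1, h2⟩ := (isConnected_minPerm J).slash_inj (isConnected_minPerm J') h
      have h3 : J = J' := Subtype.ext (by rw [← twins_minPerm, h1, twins_minPerm])
      rw [h3, ih h2]

/-- The concatenations of smallest permutations of connected pairs are the smallest permutations
of arbitrary pairs. -/
theorem range_slashList : Set.range slashList = {σ | Bottom σ.1} := by
  ext σ
  constructor
  · rintro ⟨l, rfl⟩
    induction l with
    | nil => exact fun X Y d a e => by simp [slashList, SPerm.empty] at e
    | cons J l ih => exact bottom_slash_iff.2 ⟨bottom_minPerm J, ih⟩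
  · intro hσ
    induction hn : σ.1.length using Nat.strong_induction_on generalizing σ with
    | _ n ih =>
      rcases Nat.eq_zero_or_pos n with rfl | hpos
      · exact ⟨[], (SPerm.eq_empty_iff.2 hn).symm⟩
      -- the shortest splitting position cuts off a connected factor
      have hex : ∃ k, 0 < k ∧ Split σ.1 k := ⟨n, hpos, fun a _ d hd _ h => by
        have := σ.2.mem_iff.1 hd
        omega⟩
      classical
      have hk := Nat.find_spec hex
      have hmin : ∀ j < Nat.find hex, ¬ (0 < j ∧ Split σ.1 j) := fun j hj => Nat.find_min hex hj
      have hkn : Nat.find hex ≤ n := Nat.find_min' hex ⟨hpos, fun a _ d hd _ h => by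
        have := σ.2.mem_iff.1 hd
        omega⟩
      obtain ⟨ν, π, hν, rfl⟩ := hk.2.exists_slash (by omega)
      rw [← hν] at hk hmin
      have hb := bottom_slash_iff.1 hσ
      have hc : ν.IsConnected := isConnected_iff.2
        ⟨hk.1, fun j h1 h2 h3 => hmin j h2 ⟨h1, (split_slash_iff h2.le).2 h3⟩⟩
      rw [SPerm.slash, length_slash] at hn
      obtain ⟨l, rfl⟩ := ih _ (by omega) (σ := π) hb.2 rfl
      let J : {J : TBT // J.IsConnected} := ⟨twins ν, (isConnected_twins_iff hb.1).2 hc⟩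
      refine ⟨J :: l, ?_⟩
      rw [slashList_cons, eq_of_bottom_of_twins_eq (bottom_minPerm J) hb.1 (twins_minPerm J)]

variable (K : Type*) [Field K]

/-- The algebra morphism from the free algebra to `FQSym` mapping the generator `J` to `E_J`. -/
noncomputable def freeMap : FreeAlgebra K {J : TBT // J.IsConnected} →ₐ[K] FQSym K :=
  FreeAlgebra.lift K fun J => E K J.1

theorem freeMap_basis (w : FreeMonoid {J : TBT // J.IsConnected}) :
    freeMap K (FreeAlgebra.basisFreeMonoid K _ w) = upperSum K (slashList w.toList) := by
  have h : FreeAlgebra.basisFreeMonoid K _ w = (w.toList.map (FreeAlgebra.ι K)).prod := by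
    simp [FreeAlgebra.basisFreeMonoid, FreeAlgebra.equivMonoidAlgebraFreeMonoid,
      FreeMonoid.lift_apply]
  rw [h]
  generalize w.toList = l
  induction l with
  | nil => rw [List.map_nil, List.prod_nil, map_one, ← upperSum_empty]; rfl
  | cons J l ih =>
    rw [List.map_cons, List.prod_cons, map_mul, ih, slashList_cons, ← upperSum_mul, freeMap,
      FreeAlgebra.lift_ι_apply, ← E_twins K (bottom_minPerm J), twins_minPerm]

theorem freeMap_injective : Function.Injective (freeMap K) := by
  have hinj : Function.Injective
      fun w : FreeMonoid {J : TBT // J.IsConnected} => slashList w.toList := fun w w' h =>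
    FreeMonoid.toList.injective (slashList_injective h)
  have hli : LinearIndependent K
      fun w : FreeMonoid {J : TBT // J.IsConnected} => upperSum K (slashList w.toList) :=
    LinearIndependent.comp (linearIndependent_upperSum K) _ hinj
  have h : ∀ x, freeMap K x = Finsupp.linearCombination K
      (fun w : FreeMonoid {J : TBT // J.IsConnected} => upperSum K (slashList w.toList))
      ((FreeAlgebra.basisFreeMonoid K _).repr x) := by
    intro x
    have e : ⇑(freeMap K).toLinearMap ∘ ⇑(FreeAlgebra.basisFreeMonoid K _) =
        fun w => upperSum K (slashList w.toList) := funext (freeMap_basis K)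
    rw [← e, ← Finsupp.apply_linearCombination, Module.Basis.linearCombination_repr]
    rfl
  intro x y hxy
  rw [h, h] at hxy
  exact (FreeAlgebra.basisFreeMonoid K _).repr.injective (hli hxy)

theorem toSubmodule_range_freeMap :
    Subalgebra.toSubmodule (freeMap K).range = baxterSpan K := by
  have h1 : Subalgebra.toSubmodule (freeMap K).range = LinearMap.range (freeMap K).toLinearMap :=
    rfl
  rw [h1, LinearMap.range_eq_map, ← (FreeAlgebra.basisFreeMonoid K _).span_eq,
    Submodule.map_span, baxterSpan_eq]
  congr 1
  ext x
  constructor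
  · rintro ⟨_, ⟨w, rfl⟩, rfl⟩
    have hb : slashList w.toList ∈ {σ : SPerm | Bottom σ.1} := range_slashList ▸ ⟨_, rfl⟩
    exact ⟨⟨_, hb⟩, (freeMap_basis K w).symm⟩
  · rintro ⟨⟨ν, hν⟩, rfl⟩
    have hb : ν ∈ Set.range slashList := by rw [range_slashList]; exact hν
    obtain ⟨l, rfl⟩ := hb
    exact ⟨_, ⟨FreeMonoid.ofList l, rfl⟩, freeMap_basis K _⟩

end BaxterAlgebra

theorem mainTheorem5 (K : Type*) [Field K] [CharZero K] :
    ∃ B : Subalgebra K (BaxterAlgebra.FQSym K),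
      Subalgebra.toSubmodule B = BaxterAlgebra.baxterSpan K ∧
      ∃ e : FreeAlgebra K {J : BaxterAlgebra.TBT // J.IsConnected} ≃ₐ[K] B,
        ∀ J : {J : BaxterAlgebra.TBT // J.IsConnected},
          (e (FreeAlgebra.ι K J) : BaxterAlgebra.FQSym K) = BaxterAlgebra.E K J.1 :=
  ⟨(BaxterAlgebra.freeMap K).range, BaxterAlgebra.toSubmodule_range_freeMap K,
    AlgEquiv.ofInjective (BaxterAlgebra.freeMap K) (BaxterAlgebra.freeMap_injective K), fun J => by
      rw [AlgEquiv.ofInjective_apply, BaxterAlgebra.freeMap, FreeAlgebra.lift_ι_apply]⟩
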